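/- Let $[n]=\{0,1,\dots,n-1\}$. Consider a random access machine with integer and real registers and memory cells, on which addition and subtraction, indirect memory access, comparisons, and evaluations of hash functions each take one time unit. It has access to hash functions $g_0,g_1,\dots:\mathbb{N}\to[0,1)$, all of whose values are independent and uniform on $[0,1)$; for a positive integer $m$ it may also evaluate $\lfloor m\,g_j(x)\rfloor$, a uniform element of $[m]$. There are one program and one absolute constant $C$ such that the following holds for every $u\ge 0$ and every integer $t\ge 1$. Given $t$ and the elements of a set $A\subseteq[u]$ listed in any order, the program always halts and outputs a vector $v(A)$ of $t$ non-negative real numbers that depends only on $A$, $t$ and the hash functions. Its expected running time is at most $C\,(|A|+t\log t)$ (the degenerate case $A=\emptyset$, $t=1$, where this bound is $0$, is excepted). The same hash functions are used for all sets, and the following hold. 1. For all $A,B\subseteq[u]$ and all $i\in[t]$, $v(A\cup B)_i=\min\{v(A)_i,v(B)_i\}$. 2. Let $A,B\subseteq[u]$ with $A\cup B\ne\emptyset$, let $J=|A\cap B|/|A\cup B|$, and let $X=\frac1t\,|\{i\in[t] : v(A)_i=v(B)_i\}|$. Then $\mathbb{E}[X]=J$. For every $\delta>0$, $$\Pr[X\ge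 J(1+\delta)]\le\left(\frac{e^{\delta}}{(1+\delta)^{1+\delta}}\right)^{tJ},$$ and for every $0<\delta\le 1$ (with $0^0=1$), $$\Pr[X\le J(1-\delta)]\le\left(\frac{e^{-\delta}}{(1-\delta)^{1-\delta}}\right)^{tJ}.$$ -/

import Mathlib

open MeasureTheory

noncomputable section

namespace FastSketch

/-- An infinite family of hash functions: `ω (f, x)` is the value in `[0,1)` that the hash
function number `f` takes on the key `x`. -/
abbrev HashFamily : Type := ℕ × ℕ → Set.Ico (0 : ℝ) 1

/-- The uniform distribution on `[0,1)`. -/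
def uniformIco : Measure (Set.Ico (0 : ℝ) 1) :=
  Measure.comap Subtype.val volume

instance : IsProbabilityMeasure uniformIco := by
  refine ⟨?_⟩
  rw [uniformIco, Measure.comap_apply _ Subtype.val_injective
    (fun s hs => MeasurableSet.subtype_image measurableSet_Ico hs) _ MeasurableSet.univ,
    Set.image_univ, Subtype.range_coe, Real.volume_Ico]
  simp

/-- The law of fully random hash functions: all values `ω (f, x)` are independent and
uniform on `[0,1)`. -/
def hashLaw : Measure HashFamily :=
  Measure.infinitePi (fun _ : ℕ × ℕ => uniformIco)

/-- The instructions of a random access machine with integer and real registers, an integer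
memory and a real memory (both with indirect addressing), and access to random hash functions.
Every instruction costs one time unit. There is no multiplication and no rounding of reals.
The arguments `d`, `a`, `b`, `s`, `m`, `f`, `x` are numbers of registers, `c` is a constant
and `p` a position in the program. -/
inductive Instr : Type
  /-- `I[d] := c` -/
  | const (d c : ℕ)
  /-- `I[d] := I[s]` -/
  | move (d s : ℕ)
  /-- `I[d] := I[a] + I[b]` -/
  | add (d a b : ℕ)
  /-- `I[d] := max (I[a] - I[b]) 0` -/
  | sub (d a b : ℕ)
  /-- `I[d] := M[I[a]]` -/
  | load (d a : ℕ)
  /-- `M[I[a]] := I[s]` -/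
  | store (a s : ℕ)
  /-- `R[d] := I[s]` -/
  | rofNat (d s : ℕ)
  /-- `R[d] := R[s]` -/
  | rmove (d s : ℕ)
  /-- `R[d] := R[a] + R[b]` -/
  | radd (d a b : ℕ)
  /-- `R[d] := R[a] - R[b]` -/
  | rsub (d a b : ℕ)
  /-- `R[d] := Q[I[a]]`, where `Q` is the real memory -/
  | rload (d a : ℕ)
  /-- `Q[I[a]] := R[s]`, where `Q` is the real memory -/
  | rstore (a s : ℕ)
  /-- `I[d] :=` the value of hash function number `I[f]` on the key `I[x]`,
  scaled to the range `{0, …, I[m] - 1}` -/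
  | hashNat (d m f x : ℕ)
  /-- `R[d] :=` the value in `[0,1)` of hash function number `I[f]` on the key `I[x]` -/
  | hashReal (d f x : ℕ)
  /-- go to `p` -/
  | jump (p : ℕ)
  /-- go to `p` if `I[a] < I[b]` -/
  | jumpLt (a b p : ℕ)
  /-- go to `p` if `R[a] < R[b]` -/
  | rjumpLt (a b p : ℕ)

/-- A program is a finite list of instructions; it halts when the program counter leaves it. -/
abbrev Program : Type := List Instr

/-- A configuration of the machine. -/
structure Config : Type where
  /-- program counter -/
  pc : ℕ
  /-- integer registers `I` -/
  reg : ℕ → ℕ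
  /-- real registers `R` -/
  rreg : ℕ → ℝ
  /-- integer memory `M` -/
  mem : ℕ → ℕ
  /-- real memory `Q` -/
  rmem : ℕ → ℝ

/-- Execution of one instruction. -/
def Instr.exec (ω : HashFamily) (s : Config) : Instr → Config
  | .const d c => { s with pc := s.pc + 1, reg := Function.update s.reg d c }
  | .move d a => { s with pc := s.pc + 1, reg := Function.update s.reg d (s.reg a) }
  | .add d a b => { s with pc := s.pc + 1, reg := Function.update s.reg d (s.reg a + s.reg b) }
  | .sub d a b => { s with pc := s.pc + 1, reg := Function.update s.reg d (s.reg a - s.reg b) }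
  | .load d a => { s with pc := s.pc + 1, reg := Function.update s.reg d (s.mem (s.reg a)) }
  | .store a b => { s with pc := s.pc + 1, mem := Function.update s.mem (s.reg a) (s.reg b) }
  | .rofNat d a => { s with pc := s.pc + 1, rreg := Function.update s.rreg d (s.reg a : ℝ) }
  | .rmove d a => { s with pc := s.pc + 1, rreg := Function.update s.rreg d (s.rreg a) }
  | .radd d a b =>
      { s with pc := s.pc + 1, rreg := Function.update s.rreg d (s.rreg a + s.rreg b) }
  | .rsub d a b =>
      { s with pc := s.pc + 1, rreg := Function.update s.rreg d (s.rreg a - s.rreg b) }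
  | .rload d a => { s with pc := s.pc + 1, rreg := Function.update s.rreg d (s.rmem (s.reg a)) }
  | .rstore a b => { s with pc := s.pc + 1, rmem := Function.update s.rmem (s.reg a) (s.rreg b) }
  | .hashNat d m f x =>
      { s with pc := s.pc + 1,
               reg := Function.update s.reg d
                ⌊(s.reg m : ℝ) * (ω (s.reg f, s.reg x) : ℝ)⌋₊ }
  | .hashReal d f x =>
      { s with pc := s.pc + 1,
               rreg := Function.update s.rreg d (ω (s.reg f, s.reg x) : ℝ) }
  | .jump p => { s with pc := p }
  | .jumpLt a b p => { s with pc := if s.reg a < s.reg b then p else s.pc + 1 }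
  | .rjumpLt a b p => { s with pc := if s.rreg a < s.rreg b then p else s.pc + 1 }

/-- One step of the machine; `none` if it has halted. -/
def step (P : Program) (ω : HashFamily) (s : Config) : Option Config :=
  (P[s.pc]?).map (Instr.exec ω s)

/-- `HaltsIn P ω s k s'`: started in `s`, the program `P` with hash functions `ω` halts
after exactly `k` steps, in the configuration `s'`. -/
inductive HaltsIn (P : Program) (ω : HashFamily) : Config → ℕ → Config → Prop
  | halted {s : Config} (h : step P ω s = none) : HaltsIn P ω s 0 s
  | next {s s₁ s₂ : Config} {k : ℕ} (h : step P ω s = some s₁) (h' : HaltsIn P ω s₁ k s₂) :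
      HaltsIn P ω s (k + 1) s₂

/-- The initial configuration for a sketch size `t` and a list `l` of keys: register `0` holds
`t`, register `1` holds the length of `l`, the integer memory starts with the keys of `l`,
and everything else is `0`. -/
def init (t : ℕ) {u : ℕ} (l : List (Fin u)) : Config where
  pc := 0
  reg := fun k => if k = 0 then t else if k = 1 then l.length else 0
  rreg := fun _ => 0
  mem := fun k => (l.map Fin.val).getD k 0
  rmem := fun _ => 0

/-- The Jaccard similarity `|A ∩ B| / |A ∪ B|` (used for `A ∪ B ≠ ∅`). -/
def jaccard {u : ℕ} (A B : Finset (Fin u)) : ℝ :=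
  ((A ∩ B).card : ℝ) / ((A ∪ B).card : ℝ)

/-- The fraction of the coordinates in which two vectors agree. -/
def agreement {t : ℕ} (x y : Fin t → ℝ) : ℝ :=
  (1 / (t : ℝ)) * ∑ i : Fin t, if x i = y i then 1 else 0

end FastSketch

end

noncomputable section

namespace FastSketch

/-! There are `2 * t` rounds. In round r the key a carries the value ω(r,a) + r. In the first t
rounds it goes to the uniform bin ⌊t·ω(r,a)⌋; in round t + i every key goes to bin i, so a nonempty
set leaves no bin empty. Coordinate i is the minimum over bin i, whence the union rule. Values of
round r lie in [r, r+1), so once all bins are hit the later rounds change nothing, and the program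
may stop (`sketch_eq_of_full`). With n keys this is a coupon collector making n throws per round; n
times the expected number of rounds is O(n + t log t) (`mul_sum_le`).

For similarity put U = A ∪ B. Almost surely no two keys tie within a round; then each bin has a
unique winning pair of round and key in the sketch of U, and A and B agree in that bin exactly when
the winner lies in A ∩ B (`sketch_eq_iff_wins`). Permuting U independently in each round preserves
the law of the hash functions and the sketch of U, and moves each winner by the permutation of its
round. A key enters one bin per round, so the winners of one round are distinct keys: averaged over
the permutations they are drawn without replacement within a round and independently across rounds.
Hence all bins in S are won from D with probability at most (|D|/|U|)^|S| (`measure_wins_le`). That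
bin and value come from the same hash value does no harm to this argument.

Taking D = A ∩ B and D = U \ (A ∩ B) bounds the joint probabilities of agreements and of
disagreements by those of independent events. One-element S give the exact expectation, and the
moment generating function bound `integral_prod_le` gives both Chernoff tails. -/

/-- The bin into which round `r` throws a key with hash value `x`: a uniform one in the first `t`
rounds, bin `r - t` afterwards. -/
def bin (t r : ℕ) (x : Set.Ico (0 : ℝ) 1) : ℕ :=
  ⌊((if r < t then t else 0 : ℕ) : ℝ) * (x : ℝ)⌋₊ + (r - t)

/-- The contribution of the pair `p` of a round and a key to bin `i`. -/
def entry (t : ℕ) (ω : HashFamily) (i : ℕ) (p : ℕ × ℕ) : ℝ :=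
  if bin t p.1 (ω p) = i then (ω p : ℝ) + p.1 else 2 * t

/-- The content of bin `i` after the pairs in `S` of a round and a key have been processed. -/
def partialSketch (t : ℕ) (ω : HashFamily) (S : Finset (ℕ × ℕ)) (i : ℕ) : ℝ :=
  S.fold min (2 * t : ℝ) (entry t ω i)

/-- The sketch of a set of keys. -/
def sketch (t : ℕ) (A : Finset ℕ) (ω : HashFamily) (i : ℕ) : ℝ :=
  partialSketch t ω (Finset.range (2 * t) ×ˢ A) i

/-- All bins are hit in the first `r` rounds. -/
def Full (t : ℕ) (A : Finset ℕ) (ω : HashFamily) (r : ℕ) : Prop :=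
  ∀ i < t, ∃ q < r, ∃ a ∈ A, bin t q (ω (q, a)) = i

open Classical in
/-- The number of rounds until all bins are hit. -/
def rounds (t : ℕ) (A : Finset ℕ) (ω : HashFamily) : ℕ :=
  ∑ r ∈ Finset.range (2 * t), if Full t A ω r then 0 else 1

/-! ### The program and its step count -/

/-- The program computing the sketch. -/
def sketchProgram : Program :=
  [ .const 9 1,
    .add 10 0 0,
    .rofNat 0 10,
    .jumpLt 3 0 5,
    .jump 8,
    .rstore 3 0,
    .add 3 3 9,
    .jump 3,
    .jumpLt 11 1 10,
    .jump 40,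
    .rofNat 1 2,
    .sub 5 2 0,
    .const 3 0,
    .move 6 0,
    .jumpLt 2 0 16,
    .const 6 0,
    .jumpLt 3 1 18,
    .jump 31,
    .load 7 3,
    .hashReal 2 2 7,
    .hashNat 8 6 2 7,
    .add 8 8 5,
    .radd 2 2 1,
    .rload 3 8,
    .rjumpLt 2 3 28,
    .rstore 8 3,
    .add 3 3 9,
    .jump 16,
    .rstore 8 2,
    .add 3 3 9,
    .jump 16,
    -- Register 4 points to the first bin not yet known to be hit. It only moves forward, so testing
    -- for full bins costs O(t) over all rounds plus O(1) per round.
    .jumpLt 4 0 33,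
    .jump 40,
    .rload 3 4,
    .rjumpLt 3 0 36,
    .jump 38,
    .add 4 4 9,
    .jump 31,
    .add 2 2 9,
    .jump 10 ]

/-- The running time of the program on `n` keys if it ends after `R` rounds. -/
def runTime (t n R : ℕ) : ℕ :=
  if n = 0 then 4 * t + 7 else 9 * t + 2 + ∑ r ∈ Finset.range R, (11 * n + if r < t then 13 else 14)

/-- The program gets from `s` in `c` steps to a configuration with the property `Q`. -/
def ReachTo (ω : HashFamily) (s : Config) (c : ℕ) (Q : Config → Prop) : Prop :=
  ∃ s', Q s' ∧ ∀ k f, HaltsIn sketchProgram ω s' k f → HaltsIn sketchProgram ω s (k + c) f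

/-! ### Composition of program runs -/

section ReachTo

variable {ω : HashFamily} {s : Config} {c c' : ℕ} {Q Q' : Config → Prop}

theorem ReachTo.done (h : Q s) : ReachTo ω s 0 Q := ⟨s, h, fun _ _ h => h⟩

theorem ReachTo.trans (h : ReachTo ω s c Q) (h' : ∀ s', Q s' → ReachTo ω s' c' Q') :
    ReachTo ω s (c + c') Q' := by
  obtain ⟨s', hs', h⟩ := h
  obtain ⟨s'', hs'', h'⟩ := h' s' hs'
  refine ⟨s'', hs'', fun k f hf => ?_⟩
  rw [show k + (c + c') = k + c' + c by ring]
  exact h _ _ (h' _ _ hf)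

theorem ReachTo.exec (i : Instr) (hi : sketchProgram[s.pc]? = some i)
    (h : ReachTo ω (i.exec ω s) c Q) : ReachTo ω s (c + 1) Q := by
  obtain ⟨s', hs', h⟩ := h
  refine ⟨s', hs', fun k f hf => HaltsIn.next (s₁ := i.exec ω s) ?_ (h _ _ hf)⟩
  simp [step, hi]

theorem ReachTo.cast (h : ReachTo ω s c Q) (hc : c = c') : ReachTo ω s c' Q := hc ▸ h

end ReachTo

/-! ### Effect and exact cost of each block of code -/

/-- The invariant of the main loop in round `r` with the pointer at `p`. -/
structure Ready (t r p : ℕ) (L : List ℕ) (s : Config) : Prop where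
  size : s.reg 0 = t
  length : s.reg 1 = L.length
  round : s.reg 2 = r
  pointer : s.reg 4 = p
  one : s.reg 9 = 1
  zero : s.reg 11 = 0
  top : s.rreg 0 = 2 * t
  keys : ∀ k, s.mem k = L.getD k 0

/-- The invariant of the loop over the keys. -/
structure InRound (t r : ℕ) (s : Config) : Prop where
  base : s.reg 5 = r - t
  range : s.reg 6 = if r < t then t else 0
  rround : s.rreg 1 = r

/-- The extra step for `t ≤ r` resets the hash range to 0, which makes `hashNat` return 0 and leaves
only the base `r - t`. -/
theorem reach_round {t r p : ℕ} {L : List ℕ} {s : Config} {ω : HashFamily} (h : Ready t r p L s)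
    (hpc : s.pc = 10) :
    ReachTo ω s (if r < t then 5 else 6) fun s' => Ready t r p L s' ∧ InRound t r s' ∧
      s'.pc = 16 ∧ s'.reg 3 = 0 ∧ s'.rmem = s.rmem := by
  obtain ⟨h0, h1, h2, h4, h9, h11, hr0, hm⟩ := h
  obtain ⟨pc, reg, rreg, mem, rmem⟩ := s
  simp only at h0 h1 h2 h4 h9 h11 hr0 hm hpc
  subst hpc
  by_cases hr : r < t
  · rw [if_pos hr]
    iterate 5 (refine .exec _ rfl ?_; dsimp only [Instr.exec])
    rw [if_pos (by simp [h0, h2, hr])]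
    refine .done ⟨⟨?_, ?_, ?_, ?_, ?_, ?_, ?_, ?_⟩, ⟨?_, ?_, ?_⟩, ?_, ?_, ?_⟩ <;> simp_all
  · rw [if_neg hr]
    iterate 5 (refine .exec _ rfl ?_; dsimp only [Instr.exec])
    rw [if_neg (by simp [h0, h2, hr])]
    refine .exec _ rfl ?_
    refine .done ⟨⟨?_, ?_, ?_, ?_, ?_, ?_, ?_, ?_⟩, ⟨?_, ?_, ?_⟩, ?_, ?_, ?_⟩ <;>
      simp_all [Instr.exec]

/-- When the new value is not smaller, the program writes the old content back. Both branches thus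
take equally long, and the memory effect is an update by a minimum in either case. -/
theorem reach_key {t r p j : ℕ} {L : List ℕ} {s : Config} {ω : HashFamily} (h : Ready t r p L s)
    (h' : InRound t r s) (hpc : s.pc = 16) (hj : s.reg 3 = j) (hjL : j < L.length) :
    ReachTo ω s 11 fun s' => Ready t r p L s' ∧ InRound t r s' ∧ s'.pc = 16 ∧ s'.reg 3 = j + 1 ∧
      s'.rmem = Function.update s.rmem (bin t r (ω (r, L[j])))
        (min ((ω (r, L[j]) : ℝ) + r) (s.rmem (bin t r (ω (r, L[j]))))) := by
  obtain ⟨h0, h1, h2, h4, h9, h11, hr0, hm⟩ := h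
  obtain ⟨h5, h6, hr1⟩ := h'
  obtain ⟨pc, reg, rreg, mem, rmem⟩ := s
  simp only at h0 h1 h2 h4 h9 h11 hr0 hm hpc h5 h6 hr1 hj
  subst hpc
  have hkey : mem j = L[j] := by rw [hm, List.getD_eq_getElem _ _ hjL]
  have hbin : ⌊(reg 6 : ℝ) * (ω (r, L[j]) : ℝ)⌋₊ + reg 5 = bin t r (ω (r, L[j])) := by
    rw [h5, h6, bin]
  refine .exec _ rfl ?_
  dsimp only [Instr.exec]
  rw [if_pos (by rw [hj, h1]; exact hjL)]
  iterate 6 (refine .exec _ rfl ?_; dsimp only [Instr.exec])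
  simp only [Function.update_self, Function.update_of_ne, ne_eq,
    not_false_eq_true, Nat.reduceEqDiff, hj, hkey, h2, hbin, hr1]
  generalize bin t r (ω (r, L[j])) = b at hbin
  generalize (ω (r, L[j]) : ℝ) = x at hbin
  refine .exec _ rfl ?_
  dsimp only [Instr.exec]
  by_cases hlt : x + r < rmem b
  · rw [if_pos (by simp [hlt])]
    iterate 3 (refine .exec _ rfl ?_; dsimp only [Instr.exec])
    refine .done ⟨⟨?_, ?_, ?_, ?_, ?_, ?_, ?_, ?_⟩, ⟨?_, ?_, ?_⟩, ?_, ?_, ?_⟩ <;> simp_all [le_of_lt]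
  · rw [if_neg (by simpa using hlt)]
    iterate 3 (refine .exec _ rfl ?_; dsimp only [Instr.exec])
    refine .done ⟨⟨?_, ?_, ?_, ?_, ?_, ?_, ?_, ?_⟩, ⟨?_, ?_, ?_⟩, ?_, ?_, ?_⟩ <;> simp_all

theorem reach_advance {t r p : ℕ} {L : List ℕ} {s : Config} {ω : HashFamily} (h : Ready t r p L s)
    (hpc : s.pc = 31) (hp : p < t) (hlt : s.rmem p < 2 * t) :
    ReachTo ω s 5 fun s' => Ready t r (p + 1) L s' ∧ s'.pc = 31 ∧ s'.rmem = s.rmem := by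
  obtain ⟨h0, h1, h2, h4, h9, h11, hr0, hm⟩ := h
  obtain ⟨pc, reg, rreg, mem, rmem⟩ := s
  simp only at h0 h1 h2 h4 h9 h11 hr0 hm hpc hlt
  subst hpc
  refine .exec _ rfl ?_
  dsimp only [Instr.exec]
  rw [if_pos (by rwa [h4, h0])]
  iterate 2 (refine .exec _ rfl ?_; dsimp only [Instr.exec])
  rw [if_pos (by simpa [h4, hr0] using hlt)]
  iterate 2 (refine .exec _ rfl ?_; dsimp only [Instr.exec])
  refine .done ⟨⟨?_, ?_, ?_, ?_, ?_, ?_, ?_, ?_⟩, ?_, ?_⟩ <;> simp_all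

theorem reach_next {t r p : ℕ} {L : List ℕ} {s : Config} {ω : HashFamily} (h : Ready t r p L s)
    (hpc : s.pc = 31) (hp : p < t) (hle : 2 * t ≤ s.rmem p) :
    ReachTo ω s 6 fun s' => Ready t (r + 1) p L s' ∧ s'.pc = 10 ∧ s'.rmem = s.rmem := by
  obtain ⟨h0, h1, h2, h4, h9, h11, hr0, hm⟩ := h
  obtain ⟨pc, reg, rreg, mem, rmem⟩ := s
  simp only at h0 h1 h2 h4 h9 h11 hr0 hm hpc hle
  subst hpc
  refine .exec _ rfl ?_
  dsimp only [Instr.exec]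
  rw [if_pos (by rwa [h4, h0])]
  iterate 2 (refine .exec _ rfl ?_; dsimp only [Instr.exec])
  rw [if_neg (by simpa [h4, hr0] using hle)]
  iterate 3 (refine .exec _ rfl ?_; dsimp only [Instr.exec])
  refine .done ⟨⟨?_, ?_, ?_, ?_, ?_, ?_, ?_, ?_⟩, ?_, ?_⟩ <;> simp_all

theorem reach_end {t r : ℕ} {L : List ℕ} {s : Config} {ω : HashFamily} (h : Ready t r t L s)
    (hpc : s.pc = 31) : ReachTo ω s 2 fun s' => s'.pc = 40 ∧ s'.rmem = s.rmem := by
  obtain ⟨h0, h1, h2, h4, h9, h11, hr0, hm⟩ := h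
  obtain ⟨pc, reg, rreg, mem, rmem⟩ := s
  simp only at h0 h1 h2 h4 h9 h11 hr0 hm hpc
  subst hpc
  refine .exec _ rfl ?_
  dsimp only [Instr.exec]
  rw [if_neg (by rw [h4, h0]; exact lt_irrefl _)]
  exact .exec _ rfl (.done ⟨rfl, rfl⟩)

theorem reach_keys_end {t r p : ℕ} {L : List ℕ} {s : Config} {ω : HashFamily}
    (h : Ready t r p L s) (hpc : s.pc = 16) (hj : s.reg 3 = L.length) :
    ReachTo ω s 2 fun s' => Ready t r p L s' ∧ s'.pc = 31 ∧ s'.rmem = s.rmem := by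
  obtain ⟨h0, h1, h2, h4, h9, h11, hr0, hm⟩ := h
  obtain ⟨pc, reg, rreg, mem, rmem⟩ := s
  simp only at h0 h1 h2 h4 h9 h11 hr0 hm hpc hj
  subst hpc
  refine .exec _ rfl ?_
  dsimp only [Instr.exec]
  rw [if_neg (by rw [h1, hj]; exact lt_irrefl _)]
  exact .exec _ rfl (.done ⟨⟨h0, h1, h2, h4, h9, h11, hr0, hm⟩, rfl, rfl⟩)

theorem reach_fill_step {t p : ℕ} {L : List ℕ} {s : Config} {ω : HashFamily}
    (h : Ready t 0 p L s) (hpc : s.pc = 3) {j : ℕ} (hj : s.reg 3 = j) (hjt : j < t) :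
    ReachTo ω s 4 fun s' => Ready t 0 p L s' ∧ s'.pc = 3 ∧ s'.reg 3 = j + 1 ∧
      s'.rmem = Function.update s.rmem j (2 * t) := by
  obtain ⟨h0, h1, h2, h4, h9, h11, hr0, hm⟩ := h
  obtain ⟨pc, reg, rreg, mem, rmem⟩ := s
  simp only at h0 h1 h2 h4 h9 h11 hr0 hm hpc hj
  subst hpc
  refine .exec _ rfl ?_
  dsimp only [Instr.exec]
  rw [if_pos (by rwa [hj, h0])]
  iterate 3 (refine .exec _ rfl ?_; dsimp only [Instr.exec])
  refine .done ⟨⟨?_, ?_, ?_, ?_, ?_, ?_, ?_, ?_⟩, ?_, ?_, ?_⟩ <;> simp_all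

theorem reach_start {t : ℕ} {L : List ℕ} {s : Config} {ω : HashFamily} (hpc : s.pc = 0)
    (hreg : s.reg = fun k => if k = 0 then t else if k = 1 then L.length else 0)
    (hmem : ∀ k, s.mem k = L.getD k 0) :
    ReachTo ω s 3 fun s' => Ready t 0 0 L s' ∧ s'.pc = 3 ∧ s'.reg 3 = 0 := by
  obtain ⟨pc, reg, rreg, mem, rmem⟩ := s
  simp only at hpc hreg hmem
  subst hpc hreg
  iterate 3 (refine .exec _ rfl ?_; dsimp only [Instr.exec])
  refine .done ⟨⟨?_, ?_, ?_, ?_, ?_, ?_, ?_, ?_⟩, ?_, ?_⟩ <;> simp_all [two_mul]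

theorem reach_filled {t : ℕ} {L : List ℕ} {s : Config} {ω : HashFamily}
    (h : Ready t 0 0 L s) (hpc : s.pc = 3) (hj : s.reg 3 = t) :
    ReachTo ω s (if L.length = 0 then 4 else 3) fun s' => Ready t 0 0 L s' ∧
      s'.pc = (if L.length = 0 then 40 else 10) ∧ s'.rmem = s.rmem := by
  obtain ⟨h0, h1, h2, h4, h9, h11, hr0, hm⟩ := h
  obtain ⟨pc, reg, rreg, mem, rmem⟩ := s
  simp only at h0 h1 h2 h4 h9 h11 hr0 hm hpc hj
  subst hpc
  by_cases hL : L.length = 0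
  · rw [if_pos hL, if_pos hL]
    refine .exec _ rfl ?_
    dsimp only [Instr.exec]
    rw [if_neg (by rw [hj, h0]; exact lt_irrefl _)]
    iterate 2 (refine .exec _ rfl ?_; dsimp only [Instr.exec])
    rw [if_neg (by rw [h11, h1, hL]; exact lt_irrefl _)]
    exact .exec _ rfl (.done ⟨⟨h0, h1, h2, h4, h9, h11, hr0, hm⟩, rfl, rfl⟩)
  · rw [if_neg hL, if_neg hL]
    refine .exec _ rfl ?_
    dsimp only [Instr.exec]
    rw [if_neg (by rw [hj, h0]; exact lt_irrefl _)]
    iterate 2 (refine .exec _ rfl ?_; dsimp only [Instr.exec])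
    rw [if_pos (by rw [h11, h1]; omega)]
    exact .done ⟨⟨h0, h1, h2, h4, h9, h11, hr0, hm⟩, rfl, rfl⟩

/-! ### The sketch as a minimum, and full bins -/

variable {t : ℕ} {ω : HashFamily}

/-- The lower bounds of a bin determine its content; identities between sketches are proved below by
comparing lower bounds. -/
theorem le_partialSketch_iff {S : Finset (ℕ × ℕ)} {i : ℕ} {x : ℝ} :
    x ≤ partialSketch t ω S i ↔
      x ≤ 2 * t ∧ ∀ p ∈ S, bin t p.1 (ω p) = i → x ≤ (ω p : ℝ) + p.1 := by
  rw [partialSketch, Finset.le_fold_min]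
  refine and_congr_right fun hx => forall₂_congr fun p _ => ?_
  rw [entry]
  split_ifs with h <;> simp [h, hx]

theorem partialSketch_insert (S : Finset (ℕ × ℕ)) (p : ℕ × ℕ) (i : ℕ) :
    partialSketch t ω (insert p S) i = min (entry t ω i p) (partialSketch t ω S i) := by
  rw [partialSketch, Finset.fold_insert_idem, partialSketch]

theorem partialSketch_le (S : Finset (ℕ × ℕ)) (i : ℕ) : partialSketch t ω S i ≤ 2 * t :=
  (le_partialSketch_iff.1 le_rfl).1

theorem partialSketch_le_of_mem {S : Finset (ℕ × ℕ)} {p : ℕ × ℕ} (hp : p ∈ S) :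
    partialSketch t ω S (bin t p.1 (ω p)) ≤ (ω p : ℝ) + p.1 :=
  (le_partialSketch_iff.1 le_rfl).2 p hp rfl

theorem exists_of_partialSketch_lt {S : Finset (ℕ × ℕ)} {i : ℕ}
    (h : partialSketch t ω S i < 2 * t) :
    ∃ p ∈ S, bin t p.1 (ω p) = i ∧ partialSketch t ω S i = (ω p : ℝ) + p.1 := by
  induction S using Finset.induction_on with
  | empty => simp [partialSketch] at h
  | insert p S _ ih =>
    rw [partialSketch_insert] at h ⊢
    rcases le_total (entry t ω i p) (partialSketch t ω S i) with hle | hle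
    · rw [min_eq_left hle] at h ⊢
      rw [entry] at h ⊢
      split_ifs at h ⊢ with hb
      · exact ⟨p, Finset.mem_insert_self _ _, hb, rfl⟩
      · exact absurd h (lt_irrefl _)
    · rw [min_eq_right hle] at h ⊢
      obtain ⟨q, hq, hq'⟩ := ih h
      exact ⟨q, Finset.mem_insert_of_mem hq, hq'⟩

theorem hash_nonneg (p : ℕ × ℕ) : (0 : ℝ) ≤ ω p := (ω p).2.1

theorem hash_lt_one (p : ℕ × ℕ) : (ω p : ℝ) < 1 := (ω p).2.2

/-- A pair of a round below r has value below r, while an unhit bin keeps the default `2 * t`. So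
comparing with the default tests whether a bin has been hit. -/
theorem partialSketch_lt_iff {r : ℕ} {S : Finset (ℕ × ℕ)} (hS : ∀ p ∈ S, p.1 < r) (hr : r ≤ 2 * t)
    {i : ℕ} : partialSketch t ω S i < r ↔ ∃ p ∈ S, bin t p.1 (ω p) = i := by
  constructor
  · intro h
    obtain ⟨p, hp, hpi, -⟩ := exists_of_partialSketch_lt (h.trans_le (by exact_mod_cast hr))
    exact ⟨p, hp, hpi⟩
  · rintro ⟨p, hp, rfl⟩
    refine (partialSketch_le_of_mem hp).trans_lt ?_
    have : ((p.1 + 1 : ℕ) : ℝ) ≤ r := by exact_mod_cast hS p hp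
    push_cast at this
    linarith [hash_lt_one (ω := ω) p]

theorem partialSketch_lt_top_iff {S : Finset (ℕ × ℕ)} (hS : ∀ p ∈ S, p.1 < 2 * t) {i : ℕ} :
    partialSketch t ω S i < 2 * t ↔ ∃ p ∈ S, bin t p.1 (ω p) = i := by
  simpa using partialSketch_lt_iff (i := i) hS le_rfl

theorem bin_of_le {r : ℕ} (hr : t ≤ r) (x : Set.Ico (0 : ℝ) 1) : bin t r x = r - t := by
  rw [bin, if_neg (by omega)]; simp

theorem Full.mono {A : Finset ℕ} {r r' : ℕ} (h : Full t A ω r) (hr : r ≤ r') : Full t A ω r' := by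
  intro i hi
  obtain ⟨q, hq, a, ha, e⟩ := h i hi
  exact ⟨q, hq.trans_le hr, a, ha, e⟩

theorem not_full_zero (ht : 0 < t) (A : Finset ℕ) : ¬ Full t A ω 0 := by
  intro h
  obtain ⟨q, hq, -⟩ := h 0 ht
  omega

theorem full_two_mul {A : Finset ℕ} (hA : A.Nonempty) : Full t A ω (2 * t) := by
  intro i hi
  obtain ⟨a, ha⟩ := hA
  exact ⟨t + i, by omega, a, ha, by rw [bin_of_le (by omega)]; omega⟩

theorem full_iff {A : Finset ℕ} {r : ℕ} (hr : r ≤ 2 * t) : Full t A ω r ↔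
    ∀ i < t, partialSketch t ω (Finset.range r ×ˢ A) i < 2 * t := by
  refine forall₂_congr fun i _ => ?_
  rw [partialSketch_lt_top_iff]
  · simp [and_assoc]
  · intro p hp
    simp at hp
    omega

/-- `Full` is monotone in the round, so the sum of indicators defining `rounds` counts the rounds
below the first full one. The sum form makes the expectation a sum of tail probabilities. -/
theorem exists_rounds_eq (ht : 0 < t) {A : Finset ℕ} (hA : A.Nonempty) :
    ∃ r, rounds t A ω = r + 1 ∧ r < 2 * t ∧ ¬ Full t A ω r ∧ Full t A ω (r + 1) := by
  classical
  have hex : ∃ r, Full t A ω r := ⟨_, full_two_mul hA⟩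
  have hle : Nat.find hex ≤ 2 * t := Nat.find_min' hex (full_two_mul hA)
  have hiff : ∀ r, Full t A ω r ↔ Nat.find hex ≤ r := fun r =>
    ⟨fun h => Nat.find_min' hex h, fun h => (Nat.find_spec hex).mono h⟩
  have h0 : Nat.find hex ≠ 0 := fun h => not_full_zero ht A (h ▸ Nat.find_spec hex)
  refine ⟨Nat.find hex - 1, ?_, by omega, by rw [hiff]; omega, by rw [hiff]; omega⟩
  rw [rounds, Finset.sum_ite]
  simp only [hiff, Finset.sum_const_zero, zero_add, Finset.sum_const, smul_eq_mul, mul_one, not_le]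
  rw [Finset.card_eq_of_equiv_fin (n := Nat.find hex) ?_]
  · omega
  · refine Finset.equivFinOfCardEq ?_
    rw [show (Finset.range (2 * t)).filter (· < Nat.find hex) = Finset.range (Nat.find hex) by
      ext x
      rw [Finset.mem_filter, Finset.mem_range, Finset.mem_range]
      omega, Finset.card_range]

/-- Bin i already holds a value below r, and every pair of a round from r on has value at least r.
-/
theorem sketch_eq_of_full {A : Finset ℕ} {r : ℕ} (hr : r ≤ 2 * t) (h : Full t A ω r) {i : ℕ}
    (hi : i < t) : sketch t A ω i = partialSketch t ω (Finset.range r ×ˢ A) i := by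
  refine eq_of_forall_le_iff fun x => ?_
  rw [sketch, le_partialSketch_iff, le_partialSketch_iff]
  refine and_congr_right fun _ => ⟨fun H p hp => H p ?_, fun H p hp hpi => ?_⟩
  · simp at hp ⊢
    exact ⟨by omega, hp.2⟩
  · simp at hp
    by_cases hpr : p.1 < r
    · exact H p (by simp [hp, hpr]) hpi
    · obtain ⟨q, hq, a, ha, e⟩ := h i hi
      have h1 := H (q, a) (by simp [hq, ha]) e
      have h2 : ((q + 1 : ℕ) : ℝ) ≤ p.1 := by exact_mod_cast (show q + 1 ≤ p.1 by omega)
      push_cast at h2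
      simp only at h1
      linarith [hash_lt_one (ω := ω) (q, a), hash_nonneg (ω := ω) p]

/-! ### Correctness and exact running time of the program -/

/-- The real memory holds the content of the bins after the pairs in `S` have been processed. -/
def Holds (t : ℕ) (ω : HashFamily) (S : Finset (ℕ × ℕ)) (s : Config) : Prop :=
  ∀ i < t, s.rmem i = partialSketch t ω S i

theorem reach_keys {r p : ℕ} {L : List ℕ} {s : Config} {S : Finset (ℕ × ℕ)}
    (h : Ready t r p L s) (h' : InRound t r s) (hpc : s.pc = 16) (hj : s.reg 3 = 0)
    (hS : Holds t ω S s) (j : ℕ) (hjL : j ≤ L.length) :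
    ReachTo ω s (11 * j) fun s' => Ready t r p L s' ∧ InRound t r s' ∧ s'.pc = 16 ∧ s'.reg 3 = j ∧
      Holds t ω (S ∪ {r} ×ˢ (L.take j).toFinset) s' := by
  induction j with
  | zero => exact .done ⟨h, h', hpc, hj, by simpa using hS⟩
  | succ j ih =>
    refine (ih (by omega)).trans fun s₁ ⟨g, g', gpc, gj, gS⟩ => ?_
    refine (reach_key (ω := ω) g g' gpc gj (by omega)).trans (c' := 0)
      fun s₂ ⟨f, f', fpc, fj, fr⟩ => .done ⟨f, f', fpc, fj, ?_⟩
    have hins : S ∪ {r} ×ˢ (L.take (j + 1)).toFinset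
        = insert (r, L[j]) (S ∪ {r} ×ˢ (L.take j).toFinset) := by
      rw [List.take_add_one, List.getElem?_eq_getElem (by omega)]
      ext ⟨a, b⟩
      simp only [Option.toList_some, List.toFinset_append, List.toFinset_cons, List.toFinset_nil,
        Finset.mem_union, Finset.mem_product, Finset.mem_insert, Finset.mem_singleton,
        Prod.mk.injEq, insert_empty_eq]
      tauto
    intro i hi
    rw [hins, partialSketch_insert, fr, entry, ← gS i hi]
    by_cases hb : bin t r (ω (r, L[j])) = i
    · simp [hb]
    · rw [Function.update_of_ne (Ne.symm hb), if_neg hb, min_eq_right]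
      rw [gS i hi]
      exact partialSketch_le _ _

/-- The induction is on the distance `m` of the pointer from `t`; the scan stops at the first unhit
bin at or after `p`. -/
theorem reach_pointer {r : ℕ} {L : List ℕ} (m : ℕ) {p : ℕ} {s : Config} (hm : p + m = t)
    (h : Ready t r p L s) (hpc : s.pc = 31) (hp : ∀ i < p, s.rmem i < 2 * t) :
    ∃ q, p ≤ q ∧ q ≤ t ∧ ReachTo ω s (5 * (q - p)) fun s' => Ready t r q L s' ∧ s'.pc = 31 ∧
      s'.rmem = s.rmem ∧ (∀ i < q, s.rmem i < 2 * t) ∧ (q < t → 2 * t ≤ s.rmem q) := by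
  induction m generalizing p s with
  | zero =>
    refine ⟨p, le_rfl, by omega, ?_⟩
    rw [Nat.sub_self]
    exact .done ⟨h, hpc, rfl, hp, fun hlt => by omega⟩
  | succ m ih =>
    by_cases hlt : s.rmem p < 2 * t
    · obtain ⟨s₁, ⟨g, gpc, gr⟩, hR⟩ := reach_advance (ω := ω) h hpc (by omega) hlt
      have hp' : ∀ i < p + 1, s₁.rmem i < 2 * t := by
        intro i hi
        rw [gr]
        rcases Nat.lt_succ_iff_lt_or_eq.1 hi with hi | rfl
        exacts [hp i hi, hlt]
      obtain ⟨q, hpq, hqt, hq⟩ := ih (by omega) g gpc hp'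
      refine ⟨q, by omega, hqt, ?_⟩
      have : ReachTo ω s 5 (· = s₁) := ⟨s₁, rfl, hR⟩
      refine (this.trans (c' := 5 * (q - (p + 1))) ?_).cast (by omega)
      rintro _ rfl
      rwa [gr] at hq
    · refine ⟨p, le_rfl, by omega, ?_⟩
      rw [Nat.sub_self]
      exact .done ⟨h, hpc, rfl, hp, fun _ => not_lt.1 hlt⟩

/-- The configuration before round `r`, with the pointer at `p`. -/
structure BeforeRound (t : ℕ) (ω : HashFamily) (r p : ℕ) (L : List ℕ) (s : Config) : Prop where
  ready : Ready t r p L s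
  pc : s.pc = 10
  holds : Holds t ω (Finset.range r ×ˢ L.toFinset) s
  filled : ∀ i < p, s.rmem i < 2 * t

theorem reach_full_round {r p : ℕ} {L : List ℕ} {s : Config} (hp : p ≤ t)
    (h : BeforeRound t ω r p L s) :
    ∃ q, p ≤ q ∧ q ≤ t ∧ ReachTo ω s ((11 * L.length + if r < t then 7 else 8) + 5 * (q - p))
      fun s' => Ready t r q L s' ∧ s'.pc = 31 ∧
        Holds t ω (Finset.range (r + 1) ×ˢ L.toFinset) s' ∧
        (∀ i < q, s'.rmem i < 2 * t) ∧ (q < t → 2 * t ≤ s'.rmem q) := by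
  have h1 : ReachTo ω s (11 * L.length + if r < t then 7 else 8) fun s' => Ready t r p L s' ∧
      s'.pc = 31 ∧ Holds t ω (Finset.range (r + 1) ×ˢ L.toFinset) s' := by
    refine ((reach_round h.ready h.pc).trans (c' := 11 * L.length + 2)
      fun s₁ ⟨g, g', gpc, g3, gr⟩ => ?_).cast (by split_ifs <;> omega)
    have gS : Holds t ω (Finset.range r ×ˢ L.toFinset) s₁ := fun i hi => by
      rw [gr]; exact h.holds i hi
    refine (reach_keys g g' gpc g3 gS L.length le_rfl).trans fun s₂ ⟨f, _, fpc, f3, fS⟩ => ?_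
    refine (reach_keys_end f fpc f3).trans (c' := 0) fun s₃ ⟨e, epc, er⟩ => .done ⟨e, epc, ?_⟩
    intro i hi
    rw [er, fS i hi, List.take_length, ← Finset.union_product]
    congr 2
    ext x; simp; omega
  obtain ⟨s₁, ⟨g, gpc, gS⟩, hR⟩ := h1
  -- Bin contents only decrease, so the bins passed by the pointer stay hit and need no second look.
  have hfill : ∀ i < p, s₁.rmem i < 2 * t := by
    intro i hi
    refine lt_of_le_of_lt ?_ (h.filled i hi)
    rw [gS i (by omega), h.holds i (by omega)]
    obtain ⟨e1, e2⟩ := le_partialSketch_iff.1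
      (le_refl (partialSketch t ω (Finset.range (r + 1) ×ˢ L.toFinset) i))
    refine le_partialSketch_iff.2 ⟨e1, fun x hx => e2 x ?_⟩
    simp at hx ⊢
    exact ⟨by omega, hx.2⟩
  obtain ⟨q, hpq, hqt, hq⟩ := reach_pointer (ω := ω) (t - p) (by omega) g gpc hfill
  refine ⟨q, hpq, hqt, ?_⟩
  have : ReachTo ω s _ (· = s₁) := ⟨s₁, rfl, hR⟩
  refine this.trans ?_
  rintro _ rfl
  refine hq.trans (c' := 0) fun s₂ ⟨e, epc, er, e1, e2⟩ => .done ⟨e, epc, ?_, ?_, ?_⟩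
  · intro i hi; rw [er]; exact gS i hi
  · rwa [er]
  · rwa [er]

/-- The term `5 * p` pays for all pointer moves so far at once. Since round r is reached without all
bins full, every earlier scan stopped before `t`. -/
theorem reach_beforeRound {L : List ℕ} {s : Config} (hs : BeforeRound t ω 0 0 L s) (r : ℕ)
    (hr : r < 2 * t) (hF : ¬ Full t L.toFinset ω r) :
    ∃ p ≤ t, ReachTo ω s
      (∑ q ∈ Finset.range r, (11 * L.length + if q < t then 13 else 14) + 5 * p)
      (BeforeRound t ω r p L) := by
  induction r with
  | zero => exact ⟨0, by omega, .done hs⟩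
  | succ r ih =>
    obtain ⟨p, hp, s₁, h₁, hR⟩ := ih (by omega) (fun h => hF (h.mono (by omega)))
    obtain ⟨q, hpq, hqt, s₂, ⟨g, gpc, gS, g1, g2⟩, hR'⟩ := reach_full_round hp h₁
    have hq : q < t := by
      refine lt_of_le_of_ne hqt ?_
      rintro rfl
      refine hF ((full_iff (by omega)).2 fun i hi => ?_)
      rw [← gS i hi]
      exact g1 i hi
    obtain ⟨s₃, ⟨e, epc, er⟩, hR''⟩ := reach_next (ω := ω) g gpc hq (g2 hq)
    refine ⟨q, hqt, ⟨s₃, ⟨e, epc, ?_, ?_⟩, fun k f hf => ?_⟩⟩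
    · intro i hi; rw [er]; exact gS i hi
    · rwa [er]
    · have := hR _ _ (hR' _ _ (hR'' _ _ hf))
      convert this using 1
      rw [Finset.sum_range_succ]
      split_ifs <;> omega

theorem haltsIn_sketchProgram (ht : 0 < t) {L : List ℕ} {s : Config} (hpc : s.pc = 0)
    (hreg : s.reg = fun k => if k = 0 then t else if k = 1 then L.length else 0)
    (hmem : ∀ k, s.mem k = L.getD k 0) :
    ∃ s', HaltsIn sketchProgram ω s (runTime t L.length (rounds t L.toFinset ω)) s' ∧
      ∀ i < t, s'.rmem i = sketch t L.toFinset ω i := by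
  suffices H : ReachTo ω s (runTime t L.length (rounds t L.toFinset ω)) fun s' => s'.pc = 40 ∧
      ∀ i < t, s'.rmem i = sketch t L.toFinset ω i by
    obtain ⟨s', ⟨h1, h2⟩, h⟩ := H
    refine ⟨s', ?_, h2⟩
    have := h 0 s' (.halted (by rw [step, h1]; rfl))
    rwa [zero_add] at this
  have hfill : ReachTo ω s (3 + 4 * t) fun s' => Ready t 0 0 L s' ∧ s'.pc = 3 ∧ s'.reg 3 = t ∧
      ∀ i < t, s'.rmem i = 2 * t := by
    refine (reach_start hpc hreg hmem).trans fun s₁ ⟨g, gpc, g3⟩ => ?_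
    have : ∀ j ≤ t, ReachTo ω s₁ (4 * j) fun s' => Ready t 0 0 L s' ∧ s'.pc = 3 ∧ s'.reg 3 = j ∧
        ∀ i < j, s'.rmem i = 2 * t := by
      intro j hj
      induction j with
      | zero => exact .done ⟨g, gpc, g3, by simp⟩
      | succ j ih =>
        refine (ih (by omega)).trans fun s₂ ⟨f, fpc, f3, fr⟩ => ?_
        refine (reach_fill_step f fpc f3 (by omega)).trans (c' := 0)
          fun s₃ ⟨e, epc, e3, er⟩ => .done ⟨e, epc, e3, fun i hi => ?_⟩
        rw [er]
        by_cases hij : i = j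
        · simp [hij]
        · rw [Function.update_of_ne hij]
          exact fr i (by omega)
    exact this t le_rfl
  by_cases hL : L.length = 0
  · rw [runTime, if_pos hL]
    refine (hfill.trans (c' := 4) fun s₁ ⟨g, gpc, g3, gr⟩ => ?_).cast (by omega)
    have := reach_filled (ω := ω) g gpc g3
    rw [if_pos hL, if_pos hL] at this
    refine this.trans (c' := 0) fun s₂ ⟨_, epc, er⟩ => .done ⟨epc, fun i hi => ?_⟩
    rw [er, gr i hi, List.length_eq_zero_iff.1 hL]
    simp [sketch, partialSketch]
  · rw [runTime, if_neg hL]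
    obtain ⟨r, hr, hrt, hF, hF'⟩ := exists_rounds_eq (ω := ω) ht (A := L.toFinset) (by
      rw [List.toFinset_nonempty_iff]; rintro rfl; simp at hL)
    rw [hr, Finset.sum_range_succ]
    have h0 : ReachTo ω s (4 * t + 6) (BeforeRound t ω 0 0 L) := by
      refine (hfill.trans (c' := 3) fun s₁ ⟨g, gpc, g3, gr⟩ => ?_).cast (by omega)
      have := reach_filled (ω := ω) g gpc g3
      rw [if_neg hL, if_neg hL] at this
      refine this.trans (c' := 0) fun s₂ ⟨e, epc, er⟩ => .done ⟨e, epc, fun i hi => ?_, by simp⟩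
      rw [er, gr i hi]
      simp [partialSketch]
    obtain ⟨s₀, hs₀, hR₀⟩ := h0
    obtain ⟨p, hp, s₁, h₁, hR₁⟩ := reach_beforeRound hs₀ r hrt hF
    obtain ⟨q, hpq, hqt, s₂, ⟨g, gpc, gS, g1, g2⟩, hR₂⟩ := reach_full_round hp h₁
    obtain rfl : q = t := by
      by_contra hne
      have hq : q < t := by omega
      have := (full_iff (by omega)).1 hF' q hq
      rw [← gS q hq] at this
      exact absurd this (not_lt.2 (g2 hq))
    obtain ⟨s₃, ⟨epc, er⟩, hR₃⟩ := reach_end (ω := ω) g gpc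
    refine ⟨s₃, ⟨epc, fun i hi => ?_⟩, fun k f hf => ?_⟩
    · rw [er, gS i hi, sketch_eq_of_full (by omega) hF' hi]
    -- Set-up takes 4t + 6 steps and the pointer 5t in total. Each round is charged 6 steps for
    -- passing to the next one, but the last exits in 2: hence 9t + 2.
    · have := hR₀ _ _ (hR₁ _ _ (hR₂ _ _ (hR₃ _ _ hf)))
      convert this using 1
      split_ifs <;> omega

/-! ### Chernoff bounds from bounds on intersections -/

section Chernoff

variable {Ω : Type*} [MeasurableSpace Ω] {μ : Measure Ω} [IsProbabilityMeasure μ] {t : ℕ}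
  {E : Fin t → Set Ω} {p : ℝ}

/-- Negatively correlated events have the moment generating function of a binomial variable as an
upper bound for that of their number. -/
theorem integral_prod_le (hE : ∀ i, MeasurableSet (E i))
    (hp : ∀ S : Finset (Fin t), μ.real (⋂ i ∈ S, E i) ≤ p ^ S.card) {a b : ℝ} (ha : 0 ≤ a)
    (hb : 0 ≤ b) :
    Integrable (fun ω => ∏ i, (a + (E i).indicator (fun _ => b) ω)) μ ∧
      ∫ ω, ∏ i, (a + (E i).indicator (fun _ => b) ω) ∂μ ≤ (a + b * p) ^ t := by
  -- Expanding the product over subsets leaves indicators of intersections with non-negative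
  -- coefficients, so the hypothesis applies term by term and the bound folds back into a binomial
  -- power.
  have hexp : (fun ω => ∏ i, (a + (E i).indicator (fun _ => b) ω)) = fun ω =>
      ∑ S : Finset (Fin t), (⋂ i ∈ S, E i).indicator
        (fun _ => b ^ S.card * a ^ (Finset.univ \ S).card) ω := by
    funext ω
    simp_rw [add_comm a]
    rw [Finset.prod_add, Finset.powerset_univ]
    refine Finset.sum_congr rfl fun S _ => ?_
    rw [Finset.prod_const]
    by_cases h : ∀ i ∈ S, ω ∈ E i
    · rw [Set.indicator_of_mem (by simpa using h), Finset.prod_congr rfl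
        (fun i hi => Set.indicator_of_mem (h i hi) _), Finset.prod_const]
    · rw [Set.indicator_of_notMem (by simpa using h)]
      push Not at h
      obtain ⟨i, hi, hni⟩ := h
      rw [Finset.prod_eq_zero hi (Set.indicator_of_notMem hni _), zero_mul]
  have hm : ∀ S : Finset (Fin t), MeasurableSet (⋂ i ∈ S, E i) := fun S =>
    S.measurableSet_biInter fun i _ => hE i
  have hint : ∀ S ∈ (Finset.univ : Finset (Finset (Fin t))), Integrable ((⋂ i ∈ S, E i).indicator
        (fun _ => b ^ S.card * a ^ (Finset.univ \ S).card)) μ := fun S _ =>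
    (integrable_const _).indicator (hm S)
  rw [hexp]
  refine ⟨integrable_finsetSum _ hint, ?_⟩
  rw [integral_finsetSum _ hint]
  calc _ ≤ ∑ S : Finset (Fin t), (b * p) ^ S.card * a ^ (Finset.univ \ S).card := by
        refine Finset.sum_le_sum fun S _ => ?_
        rw [integral_indicator_const _ (hm S), smul_eq_mul, mul_pow]
        have : 0 ≤ b ^ S.card * a ^ (Finset.univ \ S).card := by positivity
        nlinarith [hp S]
    _ = (a + b * p) ^ t := by
        have := Finset.prod_add (fun _ : Fin t => b * p) (fun _ => a) Finset.univ
        simp only [Finset.prod_const, Finset.card_univ, Fintype.card_fin, Finset.powerset_univ]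
          at this
        rw [add_comm a, this]

open Classical in
/-- The upper tail of the Chernoff bound for negatively correlated events. -/
theorem measure_card_ge_le (hE : ∀ i, MeasurableSet (E i)) (hp0 : 0 ≤ p)
    (hp : ∀ S : Finset (Fin t), μ.real (⋂ i ∈ S, E i) ≤ p ^ S.card) {δ : ℝ} (hδ : 0 < δ) :
    μ.real {ω | t * p * (1 + δ) ≤ ((Finset.univ.filter fun i => ω ∈ E i).card : ℝ)} ≤
      (Real.exp δ / (1 + δ) ^ (1 + δ)) ^ (t * p) := by
  -- With a = 1 and b = δ the product is (1 + δ) to the number of events, the usual choice of base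
  -- in Markov's inequality.
  obtain ⟨hint, hle⟩ := integral_prod_le hE hp zero_le_one hδ.le
  have hprod : ∀ ω, ∏ i, (1 + (E i).indicator (fun _ => δ) ω) =
      (1 + δ) ^ (Finset.univ.filter fun i => ω ∈ E i).card := by
    intro ω
    rw [← Finset.prod_const, Finset.prod_filter]
    exact Finset.prod_congr rfl fun i _ => by by_cases h : ω ∈ E i <;> simp [h]
  have h1 : (0 : ℝ) < 1 + δ := by linarith
  have hpos : (0 : ℝ) < (1 + δ) ^ (t * p * (1 + δ)) := Real.rpow_pos_of_pos h1 _
  have hmarkov := mul_meas_ge_le_integral_of_nonneg (μ := μ)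
    (Filter.Eventually.of_forall fun ω => by rw [Pi.zero_apply, hprod]; positivity) hint
    ((1 + δ) ^ (t * p * (1 + δ)))
  have hsub : μ.real {ω | t * p * (1 + δ) ≤ ((Finset.univ.filter fun i => ω ∈ E i).card : ℝ)} ≤
      μ.real {ω | (1 + δ) ^ (t * p * (1 + δ)) ≤ ∏ i, (1 + (E i).indicator (fun _ => δ) ω)} := by
    refine measureReal_mono fun ω hω => ?_
    simp only [Set.mem_ofPred_eq] at hω ⊢
    rw [hprod, ← Real.rpow_natCast]
    exact Real.rpow_le_rpow_of_exponent_le (by linarith) hω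
  have hexp : (1 + δ * p) ^ t ≤ Real.exp (δ * (t * p)) := by
    rw [show δ * (t * p) = t * (δ * p) by ring, Real.exp_nat_mul]
    exact pow_le_pow_left₀ (by positivity) (by linarith [Real.add_one_le_exp (δ * p)]) _
  rw [Real.div_rpow (Real.exp_nonneg _) (by positivity), ← Real.exp_mul, ← Real.rpow_mul h1.le,
    show (1 + δ) * (t * p) = t * p * (1 + δ) by ring, le_div_iff₀ hpos]
  calc _ ≤ _ := mul_le_mul_of_nonneg_right hsub hpos.le
    _ ≤ _ := by rw [mul_comm]; exact hmarkov
    _ ≤ _ := hle.trans hexp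

open Classical in
/-- The lower tail of the Chernoff bound for events with negatively correlated complements. -/
theorem measure_card_le_le (hE : ∀ i, MeasurableSet (E i)) (hp0 : 0 ≤ p) (hp1 : p ≤ 1)
    (hp : ∀ S : Finset (Fin t), μ.real (⋂ i ∈ S, (E i)ᶜ) ≤ (1 - p) ^ S.card) {δ : ℝ} (hδ : 0 < δ)
    (hδ1 : δ ≤ 1) :
    μ.real {ω | ((Finset.univ.filter fun i => ω ∈ E i).card : ℝ) ≤ t * p * (1 - δ)} ≤
      (Real.exp (-δ) / (1 - δ) ^ (1 - δ)) ^ (t * p) := by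
  have h1 : (0 : ℝ) ≤ 1 - δ := by linarith
  -- A factor is 1 on the complement and 1 - δ on the event, so bounds on complements control (1 -
  -- δ) to the number of events.
  obtain ⟨hint, hle⟩ := integral_prod_le (fun i => (hE i).compl) hp h1 hδ.le
  have hprod : ∀ ω, ∏ i, ((1 - δ) + ((E i)ᶜ).indicator (fun _ => δ) ω) =
      (1 - δ) ^ (Finset.univ.filter fun i => ω ∈ E i).card := by
    intro ω
    rw [← Finset.prod_const, Finset.prod_filter]
    refine Finset.prod_congr rfl fun i _ => ?_
    by_cases h : ω ∈ E i <;> simp [h]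
  -- For δ = 1 the exponent vanishes as well, and 0^0 = 1 keeps the Markov threshold positive.
  have hpos : (0 : ℝ) < (1 - δ) ^ (t * p * (1 - δ)) := by
    rcases h1.eq_or_lt with h | h
    · rw [← h]; simp
    · exact Real.rpow_pos_of_pos h _
  have hpos' : (0 : ℝ) ≤ (1 - δ) ^ (1 - δ) := Real.rpow_nonneg h1 _
  have hmarkov := mul_meas_ge_le_integral_of_nonneg (μ := μ)
    (Filter.Eventually.of_forall fun ω => by rw [Pi.zero_apply, hprod]; positivity) hint
    ((1 - δ) ^ (t * p * (1 - δ)))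
  have hsub : μ.real {ω | ((Finset.univ.filter fun i => ω ∈ E i).card : ℝ) ≤ t * p * (1 - δ)} ≤
      μ.real {ω | (1 - δ) ^ (t * p * (1 - δ)) ≤
        ∏ i, ((1 - δ) + ((E i)ᶜ).indicator (fun _ => δ) ω)} := by
    refine measureReal_mono fun ω hω => ?_
    simp only [Set.mem_ofPred_eq] at hω ⊢
    rw [hprod, ← Real.rpow_natCast]
    exact Real.rpow_le_rpow_of_exponent_ge' h1 (by linarith) (Nat.cast_nonneg _) hω
  have hexp : ((1 - δ) + δ * (1 - p)) ^ t ≤ Real.exp (-δ * (t * p)) := by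
    rw [show -δ * (t * p) = t * (-(δ * p)) by ring, Real.exp_nat_mul]
    refine pow_le_pow_left₀ (by nlinarith) ?_ _
    linarith [Real.add_one_le_exp (-(δ * p))]
  rw [Real.div_rpow (Real.exp_nonneg _) hpos', ← Real.exp_mul, ← Real.rpow_mul h1,
    show (1 - δ) * (t * p) = t * p * (1 - δ) by ring, le_div_iff₀ hpos]
  calc _ ≤ _ := mul_le_mul_of_nonneg_right hsub hpos.le
    _ ≤ _ := by rw [mul_comm]; exact hmarkov
    _ ≤ _ := hle.trans hexp

end Chernoff

/-! ### Sampling without replacement -/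

section Counting

variable {α : Type*} [Fintype α] [DecidableEq α]

/-- Double count the pairs of a permutation mapping W into D and a further point outside W that it
also maps into D. Precomposing with a transposition shows that each further point occurs equally
often, and each such permutation has |D| - |W| of them. -/
theorem card_perm_insert_mul (D W : Finset α) {w : α} (hw : w ∉ W) :
    (((Finset.univ.filter fun σ : Equiv.Perm α => ∀ x ∈ insert w W, σ x ∈ D).card : ℕ) : ℝ) *
        (Fintype.card α - W.card) =
      (Finset.univ.filter fun σ : Equiv.Perm α => ∀ x ∈ W, σ x ∈ D).card * (D.card - W.card) := by
  set N := Finset.univ.filter fun σ : Equiv.Perm α => ∀ x ∈ W, σ x ∈ D with hN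
  have hswap : ∀ w' ∈ Wᶜ, (Finset.univ.filter fun σ : Equiv.Perm α =>
      ∀ x ∈ insert w' W, σ x ∈ D).card =
      (Finset.univ.filter fun σ : Equiv.Perm α => ∀ x ∈ insert w W, σ x ∈ D).card := by
    intro w' hw'
    rw [Finset.mem_compl] at hw'
    refine Finset.card_equiv (Equiv.mulRight (Equiv.swap w w')) fun σ => ?_
    simp only [Finset.mem_filter, Finset.mem_univ, true_and, Finset.forall_mem_insert,
      Equiv.coe_mulRight, Equiv.Perm.mul_apply, Equiv.swap_apply_left]
    refine and_congr_right fun _ => forall₂_congr fun x hx => ?_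
    rw [Equiv.swap_apply_of_ne_of_ne] <;> rintro rfl <;> contradiction
  have hdouble : ∑ w' ∈ Wᶜ, (Finset.univ.filter fun σ : Equiv.Perm α =>
      ∀ x ∈ insert w' W, σ x ∈ D).card = ∑ σ ∈ N, (Wᶜ.filter fun w' => σ w' ∈ D).card := by
    have := Finset.sum_card_bipartiteAbove_eq_sum_card_bipartiteBelow
      (s := Wᶜ) (t := N) (fun w' (σ : Equiv.Perm α) => σ w' ∈ D)
    simp only [Finset.bipartiteAbove, Finset.bipartiteBelow] at this
    rw [← this]
    refine Finset.sum_congr rfl fun w' _ => ?_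
    congr 1
    ext σ
    simp [hN, and_comm]
  have hcount : ∀ σ ∈ N, (((Wᶜ.filter fun w' => σ w' ∈ D).card : ℕ) : ℝ) =
      D.card - W.card := by
    intro σ hσ
    rw [hN, Finset.mem_filter] at hσ
    have h1 : (Wᶜ.filter fun w' => σ w' ∈ D) = (D.map σ.symm.toEmbedding) \ W := by
      ext x
      simp only [Finset.mem_filter, Finset.mem_compl, Finset.mem_sdiff, Finset.mem_map_equiv,
        Equiv.symm_symm]
      tauto
    have h2 : W ⊆ D.map σ.symm.toEmbedding := fun x hx => by
      simpa [Finset.mem_map_equiv] using hσ.2 x hx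
    rw [h1, Finset.card_sdiff_of_subset h2, Nat.cast_sub (Finset.card_le_card h2),
      Finset.card_map]
  rw [Finset.sum_congr rfl hswap, Finset.sum_const, smul_eq_mul] at hdouble
  have h3 := congrArg (Nat.cast : ℕ → ℝ) hdouble
  rw [Nat.cast_sum, Finset.sum_congr rfl hcount, Finset.sum_const, nsmul_eq_mul, Nat.cast_mul,
    Finset.card_compl, Nat.cast_sub (Finset.card_le_univ W)] at h3
  linarith

/-- Sampling without replacement: at most a `(|D| / |α|) ^ |W|` fraction of the permutations map
`W` into `D`. -/
theorem card_perm_mapsTo_le (D W : Finset α) :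
    (((Finset.univ.filter fun σ : Equiv.Perm α => ∀ x ∈ W, σ x ∈ D).card : ℕ) : ℝ) ≤
      (Fintype.card α).factorial * ((D.card : ℝ) / Fintype.card α) ^ W.card := by
  induction W using Finset.induction_on with
  | empty => simp [Fintype.card_perm]
  | insert w W hw ih =>
    have hlt : (W.card : ℝ) < Fintype.card α := by
      have := Finset.card_le_univ (insert w W)
      rw [Finset.card_insert_of_notMem hw] at this
      exact_mod_cast this
    have hD : (D.card : ℝ) ≤ Fintype.card α := by exact_mod_cast Finset.card_le_univ D
    have h := card_perm_insert_mul D W hw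
    rw [Finset.card_insert_of_notMem hw, pow_succ, ← mul_assoc]
    have hα : (0 : ℝ) < Fintype.card α := (Nat.cast_nonneg _).trans_lt hlt
    refine le_trans ?_ (mul_le_mul_of_nonneg_right ih (by positivity))
    generalize (((Finset.univ.filter fun σ : Equiv.Perm α => ∀ x ∈ insert w W, σ x ∈ D).card : ℕ) :
      ℝ) = N' at h
    have hN : (0 : ℝ) ≤ ((Finset.univ.filter fun σ : Equiv.Perm α => ∀ x ∈ W, σ x ∈ D).card : ℕ) :=
      Nat.cast_nonneg _
    generalize (((Finset.univ.filter fun σ : Equiv.Perm α => ∀ x ∈ W, σ x ∈ D).card : ℕ) :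
      ℝ) = N at h hN
    have hk : (0 : ℝ) ≤ W.card := Nat.cast_nonneg _
    rw [← mul_div_assoc, le_div_iff₀ hα]
    -- With k = |W| and n = |α|, the new factor (|D| - k)/(n - k) is at most |D|/n because |D| ≤ n.
    refine le_of_mul_le_mul_right ?_ (sub_pos.2 hlt)
    calc N' * Fintype.card α * (Fintype.card α - W.card)
        = N' * (Fintype.card α - W.card) * Fintype.card α := by ring
      _ = N * ((D.card - W.card) * Fintype.card α) := by rw [h]; ring
      _ ≤ N * (D.card * (Fintype.card α - W.card)) := by
          refine mul_le_mul_of_nonneg_left ?_ hN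
          nlinarith
      _ = _ := by ring

/-- If `ρ i` is the round and `w i` the element that belongs to the index `i`, and the elements of
one round are distinct, then independent permutations of the rounds map all of them into `D` with
probability at most `(|D| / |α|) ^ |S|`. -/
theorem card_pi_perm_le {κ ι : Type*} [Fintype κ] [DecidableEq κ] [DecidableEq ι] (D : Finset α)
    (S : Finset ι) (ρ : ι → κ) (w : ι → α) (hw : ∀ i ∈ S, ∀ j ∈ S, ρ i = ρ j → w i = w j → i = j) :
    (((Finset.univ.filter fun π : κ → Equiv.Perm α => ∀ i ∈ S, π (ρ i) (w i) ∈ D).card : ℕ) : ℝ) ≤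
      Fintype.card (κ → Equiv.Perm α) * ((D.card : ℝ) / Fintype.card α) ^ S.card := by
  have h1 : (Finset.univ.filter fun π : κ → Equiv.Perm α => ∀ i ∈ S, π (ρ i) (w i) ∈ D) =
      Fintype.piFinset fun k => Finset.univ.filter fun σ : Equiv.Perm α =>
        ∀ x ∈ (S.filter (ρ · = k)).image w, σ x ∈ D := by
    ext π
    simp only [Finset.mem_filter, Finset.mem_univ, true_and, Fintype.mem_piFinset,
      Finset.forall_mem_image]
    exact ⟨fun h k i hi => hi.2 ▸ h i hi.1, fun h i hi => h _ ⟨hi, rfl⟩⟩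
  rw [h1, Fintype.card_piFinset, Nat.cast_prod]
  calc _ ≤ ∏ k, ((Fintype.card α).factorial *
        ((D.card : ℝ) / Fintype.card α) ^ (S.filter (ρ · = k)).card) := by
        refine Finset.prod_le_prod (fun _ _ => Nat.cast_nonneg _) fun k _ => ?_
        refine (card_perm_mapsTo_le D _).trans_eq ?_
        rw [Finset.card_image_of_injOn]
        intro i hi j hj hij
        simp only [Finset.coe_filter, Set.mem_ofPred_eq] at hi hj
        exact hw i hi.1 j hj.1 (hi.2.trans hj.2.symm) hij
    _ = _ := by
        rw [Finset.prod_mul_distrib, Finset.prod_pow_eq_pow_sum,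
          ← Finset.card_eq_sum_card_fiberwise (fun _ _ => Finset.mem_coe.2 (Finset.mem_univ _)),
          Finset.prod_const,
          Fintype.card_fun, Fintype.card_perm, Finset.card_univ, Nat.cast_pow]

end Counting

/-! ### Ties and winners -/

instance : IsProbabilityMeasure hashLaw := by
  unfold hashLaw; infer_instance

/-- No two keys have the same hash value in the same round. -/
def NoTies (ω : HashFamily) : Prop := ∀ r a b, ω (r, a) = ω (r, b) → a = b

/-- The entry of bin `i` in the sketch of `U` stems from an element of `D`. -/
def Wins (t : ℕ) (U D : Finset ℕ) (ω : HashFamily) (i : ℕ) : Prop :=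
  ∃ r < 2 * t, ∃ a ∈ D, bin t r (ω (r, a)) = i ∧ sketch t U ω i = (ω (r, a) : ℝ) + r

instance : NullSingletonClass uniformIco := by
  refine ⟨fun x => ?_⟩
  rw [uniformIco, Measure.comap_apply _ Subtype.val_injective
    (fun s hs => MeasurableSet.subtype_image measurableSet_Ico hs) _ (measurableSet_singleton x),
    Set.image_singleton]
  exact measure_singleton _

/-- Two distinct values have the product of two atomless laws as joint law, so the diagonal is null
by Fubini. -/
theorem hashLaw_eq_eq_zero {p q : ℕ × ℕ} (h : p ≠ q) : hashLaw {ω | ω p = ω q} = 0 := by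
  have hm : MeasurableSet {x : Set.Ico (0 : ℝ) 1 × Set.Ico (0 : ℝ) 1 | x.1 = x.2} :=
    measurableSet_eq_fun measurable_fst measurable_snd
  have h1 := Measure.infinitePi_map_eval_prod (P := fun _ : ℕ × ℕ => uniformIco) h
  have h2 : {ω : HashFamily | ω p = ω q} = (fun ω : HashFamily => (ω p, ω q)) ⁻¹'
    {x : Set.Ico (0 : ℝ) 1 × Set.Ico (0 : ℝ) 1 | x.1 = x.2} := rfl
  rw [h2, hashLaw, ← Measure.map_apply (by fun_prop) hm, h1, Measure.measure_prod_null hm]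
  refine Filter.Eventually.of_forall fun x => ?_
  have : Prod.mk x ⁻¹' {x : Set.Ico (0 : ℝ) 1 × Set.Ico (0 : ℝ) 1 | x.1 = x.2} = {x} := by
    ext y; simp [eq_comm]
  change uniformIco (Prod.mk x ⁻¹' _) = 0
  rw [this, measure_singleton]

theorem ae_noTies : ∀ᵐ ω ∂hashLaw, NoTies ω := by
  simp only [NoTies, ae_all_iff]
  intro r a b
  by_cases h : a = b
  · simp [h]
  · have := hashLaw_eq_eq_zero (p := (r, a)) (q := (r, b)) (by simp [h])
    filter_upwards [measure_eq_zero_iff_ae_notMem.1 this] with ω hω e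
    exact absurd e hω

section Winner

variable {t : ℕ} {ω : HashFamily} {U D : Finset ℕ} {i : ℕ}

/-- The hash value lies in [0,1), so the sum reveals the round as its integer part; within a round
there are no ties. -/
theorem hash_add_round_inj (h : NoTies ω) {r r' a a' : ℕ}
    (e : (ω (r, a) : ℝ) + r = (ω (r', a') : ℝ) + r') : r = r' ∧ a = a' := by
  have hr : ∀ {r r' a a' : ℕ}, (ω (r, a) : ℝ) + r = (ω (r', a') : ℝ) + r' → r ≤ r' := by
    intro r r' a a' e
    by_contra! hlt
    have : ((r' + 1 : ℕ) : ℝ) ≤ r := by exact_mod_cast hlt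
    push_cast at this
    linarith [hash_nonneg (ω := ω) (r, a), hash_lt_one (ω := ω) (r', a')]
  obtain rfl := le_antisymm (hr e) (hr e.symm)
  exact ⟨rfl, h r a a' (Subtype.ext (by linarith))⟩

theorem exists_winner (hU : U.Nonempty) (hi : i < t) : Wins t U U ω i := by
  have h := (full_iff (ω := ω) le_rfl).1 (full_two_mul hU) i hi
  obtain ⟨⟨r, a⟩, hp, hb, e⟩ := exists_of_partialSketch_lt h
  simp only [Finset.mem_product, Finset.mem_range] at hp
  exact ⟨r, hp.1, a, hp.2, hb, e⟩

theorem Wins.lt (h : Wins t U D ω i) : sketch t U ω i < 2 * t := by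
  obtain ⟨r, hr, a, -, -, e⟩ := h
  have : ((r + 1 : ℕ) : ℝ) ≤ (2 * t : ℕ) := by exact_mod_cast hr
  push_cast at this
  linarith [hash_lt_one (ω := ω) (r, a)]

theorem le_sketch_iff {x : ℝ} : x ≤ sketch t U ω i ↔
    x ≤ 2 * t ∧ ∀ r < 2 * t, ∀ a ∈ U, bin t r (ω (r, a)) = i → x ≤ (ω (r, a) : ℝ) + r := by
  rw [sketch, le_partialSketch_iff]
  simp only [Prod.forall, Finset.mem_product, Finset.mem_range, and_imp]
  exact and_congr_right fun _ => ⟨fun h r hr a ha => h r a hr ha, fun h r a hr ha => h r hr a ha⟩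

theorem sketch_nonneg : 0 ≤ sketch t U ω i :=
  le_sketch_iff.2 ⟨by positivity, fun r _ a _ _ =>
    add_nonneg (hash_nonneg _) (Nat.cast_nonneg _)⟩

theorem sketch_union (A B : Finset ℕ) :
    sketch t (A ∪ B) ω i = min (sketch t A ω i) (sketch t B ω i) := by
  refine eq_of_forall_le_iff fun x => ?_
  rw [le_min_iff, le_sketch_iff, le_sketch_iff, le_sketch_iff]
  simp only [Finset.mem_union]
  constructor
  · rintro ⟨h1, h2⟩
    exact ⟨⟨h1, fun r hr a ha => h2 r hr a (.inl ha)⟩, ⟨h1, fun r hr a ha => h2 r hr a (.inr ha)⟩⟩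
  · rintro ⟨⟨h1, h2⟩, -, h3⟩
    exact ⟨h1, fun r hr a ha => ha.elim (h2 r hr a) (h3 r hr a)⟩

/-- A common content is attained by a pair from A and by one from B, and without ties these
coincide. Conversely a winner in A ∩ B bounds both contents above by their minimum. -/
theorem sketch_eq_iff_wins (h : NoTies ω) {A B : Finset ℕ} (hU : (A ∪ B).Nonempty) (hi : i < t) :
    sketch t A ω i = sketch t B ω i ↔ Wins t (A ∪ B) (A ∩ B) ω i := by
  constructor
  · intro e
    have hlt := (exists_winner (ω := ω) hU hi).lt
    rw [sketch_union, ← e, min_self] at hlt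
    obtain ⟨⟨r, a⟩, hp, hb, e1⟩ := exists_of_partialSketch_lt hlt
    obtain ⟨⟨r', a'⟩, hp', hb', e2⟩ := exists_of_partialSketch_lt (e ▸ hlt)
    simp only [Finset.mem_product, Finset.mem_range] at hp hp'
    obtain ⟨rfl, rfl⟩ := hash_add_round_inj h (e1.symm.trans (e.trans e2))
    refine ⟨r, hp.1, a, Finset.mem_inter.2 ⟨hp.2, hp'.2⟩, hb, ?_⟩
    rw [sketch_union, ← e, min_self]
    exact e1
  · rintro ⟨r, hr, a, ha, hb, e⟩
    rw [Finset.mem_inter] at ha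
    have h1 := (le_sketch_iff.1 (le_refl (sketch t A ω i))).2 r hr a ha.1 hb
    have h2 := (le_sketch_iff.1 (le_refl (sketch t B ω i))).2 r hr a ha.2 hb
    rw [sketch_union] at e
    have h3 := min_le_left (sketch t A ω i) (sketch t B ω i)
    have h4 := min_le_right (sketch t A ω i) (sketch t B ω i)
    linarith

theorem wins_sdiff_iff (h : NoTies ω) (hU : U.Nonempty) (hi : i < t) :
    Wins t U (U \ D) ω i ↔ ¬ Wins t U D ω i := by
  obtain ⟨r, hr, a, ha, hb, e⟩ := exists_winner (ω := ω) hU hi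
  constructor
  · rintro ⟨r₁, -, a₁, h₁, -, e₁⟩ ⟨r₂, -, a₂, h₂, -, e₂⟩
    obtain ⟨-, rfl⟩ := hash_add_round_inj h (e₁.symm.trans e₂)
    exact (Finset.mem_sdiff.1 h₁).2 h₂
  · intro hn
    exact ⟨r, hr, a, Finset.mem_sdiff.2 ⟨ha, fun haD => hn ⟨r, hr, a, haD, hb, e⟩⟩, hb, e⟩

end Winner

/-! ### Measurability -/

section Measurability

variable {t : ℕ}

theorem measurable_bin (r : ℕ) : Measurable (bin t r) := by
  unfold bin
  exact (Nat.measurable_floor.comp (measurable_const.mul measurable_subtype_coe)).add_const _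

theorem measurable_sketch (A : Finset ℕ) (i : ℕ) : Measurable fun ω => sketch t A ω i := by
  unfold sketch
  induction Finset.range (2 * t) ×ˢ A using Finset.induction_on with
  | empty => simp [partialSketch]
  | insert p S _ ih =>
    simp only [partialSketch_insert]
    refine Measurable.min ?_ ih
    unfold entry
    have hp : Measurable fun ω : HashFamily => ω p := measurable_pi_apply p
    exact Measurable.ite ((measurable_bin _).comp hp (measurableSet_singleton i))
      ((measurable_subtype_coe.comp hp).add_const _) measurable_const

theorem measurableSet_bin_eq (r a i : ℕ) :
    MeasurableSet {ω : HashFamily | bin t r (ω (r, a)) = i} :=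
  ((measurable_bin r).comp (measurable_pi_apply (r, a))) (measurableSet_singleton i)

theorem measurableSet_wins (U D : Finset ℕ) (i : ℕ) : MeasurableSet {ω | Wins t U D ω i} := by
  have : {ω | Wins t U D ω i} = ⋃ r ∈ Finset.range (2 * t), ⋃ a ∈ D,
      {ω : HashFamily | bin t r (ω (r, a)) = i} ∩
        {ω | sketch t U ω i = (ω (r, a) : ℝ) + r} := by
    ext ω; simp [Wins, and_left_comm]
  rw [this]
  refine Finset.measurableSet_biUnion _ fun r _ => Finset.measurableSet_biUnion _ fun a _ => ?_
  exact (measurableSet_bin_eq r a i).inter (measurableSet_eq_fun (measurable_sketch U i)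
    ((measurable_subtype_coe.comp (measurable_pi_apply (r, a))).add_const _))

end Measurability

/-! ### Permuting the keys within each round -/

section Symmetry

variable {t : ℕ} {U : Finset ℕ}

/-- Apply the permutation `π r` of `U` to the keys in round `r`. -/
def permuteKey (π : Fin (2 * t) → Equiv.Perm U) (p : ℕ × ℕ) : ℕ × ℕ :=
  (p.1, if h : p.1 < 2 * t then Equiv.Perm.ofSubtype (π ⟨p.1, h⟩)⁻¹ p.2 else p.2)

/-- The hash functions with the keys of `U` permuted in every round. -/
def permute (π : Fin (2 * t) → Equiv.Perm U) (ω : HashFamily) : HashFamily :=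
  fun p => ω (permuteKey π p)

theorem permuteKey_injective (π : Fin (2 * t) → Equiv.Perm U) :
    Function.Injective (permuteKey π) := by
  rintro ⟨r, a⟩ ⟨r', a'⟩ h
  simp only [permuteKey, Prod.mk.injEq] at h
  obtain ⟨rfl, h⟩ := h
  split_ifs at h
  · rw [(Equiv.injective _) h]
  · rw [h]

theorem measurePreserving_permute (π : Fin (2 * t) → Equiv.Perm U) :
    MeasurePreserving (permute π) hashLaw hashLaw := by
  refine ⟨measurable_pi_lambda _ fun p => measurable_pi_apply _, ?_⟩
  exact Measure.map_infinitePi_infinitePi_of_inj (P := fun _ : ℕ × ℕ => uniformIco)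
    (permuteKey_injective π)

/-- The inverse in `permuteKey` serves this form: the permuted functions give π(a) the hash value of
a, so winners move by π. -/
theorem permute_apply (π : Fin (2 * t) → Equiv.Perm U) (ω : HashFamily) {r : ℕ} (hr : r < 2 * t)
    (a : U) : permute π ω (r, π ⟨r, hr⟩ a) = ω (r, a) := by
  simp only [permute, permuteKey, dif_pos hr]
  rw [Equiv.Perm.ofSubtype_apply_coe, Equiv.Perm.inv_def, Equiv.symm_apply_apply]

theorem forall_mem_permute (π : Fin (2 * t) → Equiv.Perm U) {r : ℕ} (hr : r < 2 * t)
    {Q : ℕ → Prop} : (∀ a ∈ U, Q a) ↔ ∀ a : U, Q (π ⟨r, hr⟩ a) := by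
  constructor
  · exact fun h a => h _ (π ⟨r, hr⟩ a).2
  · intro h a ha
    have := h ((π ⟨r, hr⟩)⁻¹ ⟨a, ha⟩)
    simpa using this

theorem sketch_permute (π : Fin (2 * t) → Equiv.Perm U) (ω : HashFamily) (i : ℕ) :
    sketch t U (permute π ω) i = sketch t U ω i := by
  refine eq_of_forall_le_iff fun x => ?_
  rw [le_sketch_iff, le_sketch_iff]
  refine and_congr_right fun _ => forall₂_congr fun r hr => ?_
  rw [forall_mem_permute π hr]
  simp only [permute_apply, Subtype.forall]

theorem wins_permute (π : Fin (2 * t) → Equiv.Perm U) {ω : HashFamily} (hω : NoTies ω)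
    {D : Finset ℕ} {i r : ℕ} (hr : r < 2 * t) {a : U}
    (e : sketch t U ω i = (ω (r, (a : ℕ)) : ℝ) + r) (hDU : D ⊆ U)
    (h : Wins t U D (permute π ω) i) : ((π ⟨r, hr⟩ a : U) : ℕ) ∈ D := by
  obtain ⟨r', hr', b, hb, -, e'⟩ := h
  obtain ⟨c, hc⟩ : ∃ c : U, (π ⟨r', hr'⟩ c : ℕ) = b :=
    ⟨(π ⟨r', hr'⟩)⁻¹ ⟨b, hDU hb⟩, by simp⟩
  rw [sketch_permute, ← hc, permute_apply] at e'
  obtain ⟨rfl, h⟩ := hash_add_round_inj hω (e.symm.trans e')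
  rwa [Subtype.ext h, hc]

/-- The probability that the winners of the bins in `S` all lie in `D` is at most what it would be
if the winners were independent. -/
theorem measure_wins_le (hU : U.Nonempty) {D : Finset ℕ} (hDU : D ⊆ U) (S : Finset (Fin t)) :
    hashLaw.real {ω | ∀ i ∈ S, Wins t U D ω i} ≤ ((D.card : ℝ) / U.card) ^ S.card := by
  classical
  set E := {ω | ∀ i ∈ S, Wins t U D ω i} with hE
  have hEm : MeasurableSet E := by
    have : E = ⋂ i ∈ S, {ω | Wins t U D ω i} := by ext; simp [hE]
    rw [this]
    exact S.measurableSet_biInter fun i _ => measurableSet_wins U D i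
  -- For fixed hash functions without ties, count the permutation families that send all winners of
  -- the bins in S into D. The probability bound follows by integrating over ω.
  have hpoint : ∀ᵐ ω ∂hashLaw, ∑ π : Fin (2 * t) → Equiv.Perm U,
      (permute π ⁻¹' E).indicator (fun _ => (1 : ℝ)) ω ≤
      Fintype.card (Fin (2 * t) → Equiv.Perm U) * ((D.card : ℝ) / U.card) ^ S.card := by
    filter_upwards [ae_noTies] with ω hω
    choose r hr a ha hb e using fun i : Fin t => exists_winner (ω := ω) hU i.2
    have hcard := card_pi_perm_le (D.subtype (· ∈ U)) S (fun i => (⟨r i, hr i⟩ : Fin (2 * t)))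
      (fun i => (⟨a i, ha i⟩ : U)) (by
        -- Equal round and equal key force the same bin, so distinct bins of one round have distinct
        -- winners.
        intro i _ j _ hρ hw
        simp only [Fin.mk.injEq, Subtype.mk.injEq] at hρ hw
        refine Fin.ext ?_
        rw [← hb i, ← hb j, hρ, hw])
    rw [Finset.card_subtype, Finset.filter_true_of_mem (fun x hx => hDU hx), Fintype.card_coe]
      at hcard
    refine le_trans ?_ hcard
    rw [Finset.card_filter, Nat.cast_sum]
    refine Finset.sum_le_sum fun π _ => ?_
    by_cases hπ : ω ∈ permute π ⁻¹' E
    · rw [Set.indicator_of_mem hπ, if_pos]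
      · simp
      · intro i hi
        rw [Finset.mem_subtype]
        exact wins_permute π hω (hr i) (e i) hDU (hπ i hi)
    · rw [Set.indicator_of_notMem hπ]
      exact Nat.cast_nonneg _
  have hm : ∀ π : Fin (2 * t) → Equiv.Perm U, MeasurableSet (permute π ⁻¹' E) := fun π =>
    (measurePreserving_permute π).measurable hEm
  have hint : ∀ π ∈ (Finset.univ : Finset (Fin (2 * t) → Equiv.Perm U)),
      Integrable ((permute π ⁻¹' E).indicator (fun _ => (1 : ℝ))) hashLaw := fun π _ =>
    (integrable_const _).indicator (hm π)
  have h := integral_mono_ae (integrable_finsetSum _ hint) (integrable_const _) hpoint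
  rw [integral_finsetSum _ hint, integral_const, probReal_univ, one_smul] at h
  -- Every permuted event has the probability of the original one, so the sum over π is a multiple
  -- of it.
  have hE' : ∀ π : Fin (2 * t) → Equiv.Perm U,
      ∫ ω, (permute π ⁻¹' E).indicator (fun _ => (1 : ℝ)) ω ∂hashLaw = hashLaw.real E := by
    intro π
    rw [integral_indicator_const _ (hm π), smul_eq_mul, mul_one]
    exact (measurePreserving_permute π).measureReal_preimage hEm.nullMeasurableSet
  rw [Finset.sum_congr rfl fun π _ => hE' π, Finset.sum_const, nsmul_eq_mul,
    Finset.card_univ] at h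
  exact le_of_mul_le_mul_left h (by exact_mod_cast Fintype.card_pos)

end Symmetry

/-! ### Expected running time -/

section Time

variable {t : ℕ}

theorem measurableSet_not_full (A : Finset ℕ) (r : ℕ) :
    MeasurableSet {ω : HashFamily | ¬ Full t A ω r} := by
  have : {ω : HashFamily | ¬ Full t A ω r} = (⋂ i ∈ Finset.range t, ⋃ q ∈ Finset.range r, ⋃ a ∈ A,
      {ω : HashFamily | bin t q (ω (q, a)) = i})ᶜ := by
    ext ω; simp [Full]
  rw [this]
  exact (Finset.measurableSet_biInter _ fun i _ => Finset.measurableSet_biUnion _ fun q _ =>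
    Finset.measurableSet_biUnion _ fun a _ => measurableSet_bin_eq q a i).compl

theorem uniformIco_bin_ne {r i : ℕ} (hr : r < t) (hi : i < t) :
    uniformIco.real {x | bin t r x ≠ i} = 1 - 1 / t := by
  have ht : (0 : ℝ) < t := by exact_mod_cast (Nat.zero_le r).trans_lt hr
  have hm : MeasurableSet {x | bin t r x = i} := measurable_bin r (measurableSet_singleton i)
  have himage : (Subtype.val : Set.Ico (0 : ℝ) 1 → ℝ) '' {x | bin t r x = i} =
      Set.Ico ((i : ℝ) / t) ((i + 1) / t) := by
    have hi1 : ((i + 1 : ℕ) : ℝ) ≤ t := by exact_mod_cast hi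
    push_cast at hi1
    ext y
    simp only [Set.mem_image, Set.mem_ofPred_eq, Subtype.exists, exists_and_right, exists_eq_right,
      Set.mem_Ico, bin, if_pos hr, Nat.sub_eq_zero_of_le hr.le, add_zero]
    rw [div_le_iff₀ ht, lt_div_iff₀ ht]
    constructor
    · rintro ⟨hy, h⟩
      rw [Nat.floor_eq_iff (mul_nonneg ht.le hy.1)] at h
      exact ⟨by linarith [h.1], by linarith [h.2]⟩
    · rintro ⟨h1, h2⟩
      have hy0 : 0 ≤ y := by
        by_contra! hneg
        nlinarith [(Nat.cast_nonneg i : (0 : ℝ) ≤ i)]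
      refine ⟨⟨hy0, by nlinarith⟩, ?_⟩
      rw [Nat.floor_eq_iff (mul_nonneg ht.le hy0)]
      exact ⟨by linarith, by linarith⟩
  have h : uniformIco.real {x | bin t r x = i} = 1 / t := by
    rw [Measure.real, uniformIco, Measure.comap_apply _ Subtype.val_injective
      (fun s hs => MeasurableSet.subtype_image measurableSet_Ico hs) _ hm, himage, Real.volume_Ico,
      ENNReal.toReal_ofReal]
    · ring
    · rw [← sub_div]
      have : (i : ℝ) + 1 - i = 1 := by ring
      rw [this]; positivity
  rw [show {x | bin t r x ≠ i} = {x | bin t r x = i}ᶜ from rfl, probReal_compl_eq_one_sub hm, h]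

/-- For r ≤ t all r rounds throw at random, so r·|A| independent throws have to miss the bin. -/
theorem measure_bin_unhit {r i : ℕ} (hr : r ≤ t) (hi : i < t) (A : Finset ℕ) :
    hashLaw.real {ω | ¬ ∃ q < r, ∃ a ∈ A, bin t q (ω (q, a)) = i} = (1 - 1 / t) ^ (r * A.card) := by
  have : {ω : HashFamily | ¬ ∃ q < r, ∃ a ∈ A, bin t q (ω (q, a)) = i} =
      Set.pi ((Finset.range r ×ˢ A : Finset (ℕ × ℕ)) : Set (ℕ × ℕ))
        fun p => {x | bin t p.1 x ≠ i} := by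
    ext ω
    simp only [Set.mem_ofPred_eq, not_exists, not_and, Set.mem_pi, Finset.mem_coe,
      Finset.mem_product, Finset.mem_range, Prod.forall, and_imp, ne_eq]
    exact ⟨fun h q a hq ha => h q hq a ha, fun h q hq a ha => h q a hq ha⟩
  rw [this, Measure.real, hashLaw, Measure.infinitePi_pi, ENNReal.toReal_prod]
  · rw [Finset.prod_congr rfl (g := fun _ => 1 - 1 / (t : ℝ))]
    · rw [Finset.prod_const, Finset.card_product, Finset.card_range]
    · intro p hp
      simp only [Finset.mem_product, Finset.mem_range] at hp
      exact uniformIco_bin_ne (hp.1.trans_le hr) hi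
  · intro p _
    exact (measurable_bin _ (measurableSet_singleton i)).compl

theorem measure_not_full_le {r : ℕ} (hr : r ≤ t) (A : Finset ℕ) :
    hashLaw.real {ω | ¬ Full t A ω r} ≤ t * (1 - 1 / t) ^ (r * A.card) := by
  have : {ω : HashFamily | ¬ Full t A ω r} =
      ⋃ i ∈ Finset.range t, {ω | ¬ ∃ q < r, ∃ a ∈ A, bin t q (ω (q, a)) = i} := by
    ext ω; simp [Full]
  rw [this]
  refine (measureReal_biUnion_finset_le _ _).trans ?_
  rw [Finset.sum_congr rfl fun i hi => measure_bin_unhit hr (Finset.mem_range.1 hi) A]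
  simp

/-- The expected number of rounds of the coupon collector, up to a factor of two. -/
theorem mul_sum_le {n : ℕ} (ht : 0 < t) (hn : 0 < n) {f : ℕ → ℝ} (hf1 : ∀ r, f r ≤ 1)
    (hf : ∀ r < t, f r ≤ t * (1 - 1 / t) ^ (r * n)) :
    n * ∑ r ∈ Finset.range t, f r ≤ t * Real.log t + 2 * n + t := by
  have ht' : (1 : ℝ) ≤ t := by exact_mod_cast ht
  have hn' : (0 : ℝ) < n := by exact_mod_cast hn
  have ht0 : (0 : ℝ) < t := by linarith
  set x : ℝ := (1 - 1 / t) ^ n with hx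
  have hq : (0 : ℝ) ≤ 1 - 1 / t := by
    rw [sub_nonneg, div_le_one ht0]; exact ht'
  have hx0 : 0 ≤ x := pow_nonneg hq _
  have hxe : x ≤ Real.exp (-(n / t)) := by
    rw [show -((n : ℝ) / t) = n * (-(1 / t)) by ring, Real.exp_nat_mul]
    exact pow_le_pow_left₀ hq (by linarith [Real.add_one_le_exp (-(1 / (t : ℝ)))]) _
  -- From x ≤ e^(-n/t) ≤ 1/(1 + n/t). Equivalently n ≤ (t + n)(1 - x), which bounds n/(1 - x), the
  -- weight of the geometric tail, by t + n.
  have hxt : x * (t + n) ≤ t := by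
    have h1 : Real.exp (-(n / t)) * (1 + n / t) ≤ 1 := by
      calc _ ≤ Real.exp (-(n / t)) * Real.exp (n / t) :=
            mul_le_mul_of_nonneg_left (by linarith [Real.add_one_le_exp ((n : ℝ) / t)])
              (Real.exp_nonneg _)
        _ = 1 := by rw [← Real.exp_add]; simp
    calc x * (t + n) = x * (1 + n / t) * t := by field_simp
      _ ≤ Real.exp (-(n / t)) * (1 + n / t) * t := by gcongr
      _ ≤ 1 * t := by gcongr
      _ = t := one_mul _
  have hx1 : x < 1 := by nlinarith
  -- After K rounds the union bound t·x^K drops to 1; earlier terms are bounded by 1 and later ones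
  -- by a geometric series.
  set K := ⌈(t : ℝ) * Real.log t / n⌉₊ with hK
  have hlog : 0 ≤ Real.log t := Real.log_nonneg ht'
  have hK1 : (t : ℝ) * Real.log t ≤ n * K := by
    have := Nat.le_ceil ((t : ℝ) * Real.log t / n)
    rw [div_le_iff₀ hn'] at this
    linarith
  have hK2 : (n : ℝ) * K ≤ t * Real.log t + n := by
    have := (Nat.ceil_lt_add_one (by positivity : 0 ≤ (t : ℝ) * Real.log t / n)).le
    calc (n : ℝ) * K ≤ n * (t * Real.log t / n + 1) := by gcongr
      _ = _ := by field_simp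
  have hxK : t * x ^ K ≤ 1 := by
    have h1 : x ^ K ≤ Real.exp (-Real.log t) := by
      calc x ^ K ≤ Real.exp (-(n / t)) ^ K := pow_le_pow_left₀ hx0 hxe _
        _ = Real.exp (-(n * K / t)) := by rw [← Real.exp_nat_mul]; ring_nf
        _ ≤ _ := by
          rw [Real.exp_le_exp, neg_le_neg_iff, le_div_iff₀ ht0]
          linarith
    rw [Real.exp_neg, Real.exp_log ht0] at h1
    calc t * x ^ K ≤ t * (t : ℝ)⁻¹ := by gcongr
      _ = 1 := mul_inv_cancel₀ ht0.ne'
  have hfg : ∀ r < t, f r ≤ if r < K then 1 else x ^ (r - K) := by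
    intro r hr
    split_ifs with h
    · exact hf1 r
    · refine (hf r hr).trans ?_
      rw [mul_comm r, pow_mul, ← hx]
      calc t * x ^ r = t * x ^ K * x ^ (r - K) := by
            rw [mul_assoc, ← pow_add, Nat.add_sub_cancel' (not_lt.1 h)]
        _ ≤ 1 * x ^ (r - K) := by gcongr
        _ = _ := one_mul _
  have hgeom : (1 - x) * ∑ j ∈ Finset.range t, x ^ j ≤ 1 := by
    rw [mul_neg_geom_sum]
    linarith [pow_nonneg hx0 t]
  have hsum : ∑ r ∈ Finset.range t, f r ≤ K + ∑ j ∈ Finset.range t, x ^ j := by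
    calc _ ≤ ∑ r ∈ Finset.range t, (if r < K then 1 else x ^ (r - K)) :=
          Finset.sum_le_sum fun r hr => hfg r (Finset.mem_range.1 hr)
      _ ≤ ∑ r ∈ Finset.range (K + t), (if r < K then 1 else x ^ (r - K)) := by
          refine Finset.sum_le_sum_of_subset_of_nonneg
            (Finset.range_subset_range.2 (Nat.le_add_left _ _)) fun r _ _ => ?_
          split_ifs <;> positivity
      _ = _ := by
          rw [Finset.sum_range_add]
          congr 1
          · rw [Finset.sum_congr rfl fun r hr => if_pos (Finset.mem_range.1 hr)]
            simp
          · simp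
  set G := ∑ j ∈ Finset.range t, x ^ j with hG
  have hnG : n * G ≤ n + t := by
    have hG0 : 0 ≤ G := Finset.sum_nonneg fun j _ => pow_nonneg hx0 j
    have h2 : (n : ℝ) ≤ (t + n) * (1 - x) := by linarith
    nlinarith
  calc _ ≤ n * (K + G) := by gcongr
    _ ≤ _ := by linarith

theorem measurable_rounds (A : Finset ℕ) : Measurable fun ω => rounds t A ω := by
  unfold rounds
  refine Finset.measurable_fun_sum _ fun r _ => ?_
  have := (measurableSet_not_full (t := t) A r).compl
  refine Measurable.ite ?_ measurable_const measurable_const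
  convert this using 1
  ext ω; simp

theorem rounds_le (A : Finset ℕ) (ω : HashFamily) : rounds t A ω ≤ 2 * t := by
  unfold rounds
  calc _ ≤ ∑ r ∈ Finset.range (2 * t), 1 := Finset.sum_le_sum fun r _ => by split_ifs <;> simp
    _ = _ := by simp

theorem integrable_rounds (A : Finset ℕ) :
    Integrable (fun ω => (rounds t A ω : ℝ)) hashLaw := by
  refine Integrable.of_bound (C := (2 * t : ℕ))
    (measurable_from_top.comp (measurable_rounds A)).aestronglyMeasurable
    (Filter.Eventually.of_forall fun ω => ?_)
  rw [Real.norm_natCast]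
  exact_mod_cast rounds_le A ω

/-- The tail estimate covers only the t random rounds. By monotonicity of `Full` the other t tail
probabilities sum to no more than the first t, hence the factor 2. -/
theorem mul_integral_rounds_le (ht : 0 < t) {A : Finset ℕ} (hA : A.Nonempty) :
    A.card * ∫ ω, (rounds t A ω : ℝ) ∂hashLaw ≤
      2 * (t * Real.log t + 2 * A.card + t) := by
  have h1 : (fun ω => (rounds t A ω : ℝ)) = fun ω => ∑ r ∈ Finset.range (2 * t),
      {ω | ¬ Full t A ω r}.indicator (fun _ => (1 : ℝ)) ω := by
    funext ω
    rw [rounds, Nat.cast_sum]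
    refine Finset.sum_congr rfl fun r _ => ?_
    by_cases h : Full t A ω r <;> simp [h]
  rw [h1, integral_finsetSum _ fun r _ => (integrable_const _).indicator
    (measurableSet_not_full A r)]
  simp only [integral_indicator_const _ (measurableSet_not_full A _), smul_eq_mul, mul_one]
  have h2 := mul_sum_le ht hA.card_pos (f := fun r => hashLaw.real {ω | ¬ Full t A ω r})
    (fun r => measureReal_le_one) (fun r hr => measure_not_full_le hr.le A)
  have h3 : ∑ r ∈ Finset.range t, hashLaw.real {ω | ¬ Full t A ω (t + r)} ≤
      ∑ r ∈ Finset.range t, hashLaw.real {ω | ¬ Full t A ω r} :=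
    Finset.sum_le_sum fun r _ => measureReal_mono fun ω hω hF => hω (hF.mono (by omega))
  rw [two_mul t, Finset.sum_range_add]
  have h4 : (0 : ℝ) ≤ A.card := Nat.cast_nonneg _
  nlinarith

theorem lintegral_runTime_le (ht : 0 < t) (A : Finset ℕ) (hAt : A.Nonempty ∨ 2 ≤ t) :
    ∫⁻ ω, (runTime t A.card (rounds t A ω) : ENNReal) ∂hashLaw ≤
      ENNReal.ofReal (200 * (A.card + t * Real.log t)) := by
  have ht1 : (1 : ℝ) ≤ t := by exact_mod_cast ht
  have hlog0 : 0 ≤ t * Real.log t := mul_nonneg (by linarith) (Real.log_nonneg ht1)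
  -- Since log 2 > 1/2. This absorbs the linear cost of the bins into t log t; for t = 1 a nonempty
  -- A absorbs it instead.
  have hlog : 2 ≤ t → (t : ℝ) ≤ 2 * (t * Real.log t) := by
    intro h
    have h2 : Real.log 2 ≤ Real.log t := Real.log_le_log (by norm_num) (by exact_mod_cast h)
    have := Real.log_two_gt_d9
    nlinarith
  rcases A.eq_empty_or_nonempty with rfl | hA
  · have h2 : 2 ≤ t := hAt.resolve_left (by simp)
    simp only [runTime, Finset.card_empty, if_true, lintegral_const, measure_univ, mul_one]
    rw [← ENNReal.ofReal_natCast]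
    refine ENNReal.ofReal_le_ofReal ?_
    have := hlog h2
    push_cast
    linarith
  · have hn : (1 : ℝ) ≤ A.card := by exact_mod_cast hA.card_pos
    have hpt : ∀ ω, (runTime t A.card (rounds t A ω) : ENNReal) ≤
        ENNReal.ofReal (9 * t + 2 + 25 * (A.card * (rounds t A ω : ℝ))) := by
      intro ω
      rw [← ENNReal.ofReal_natCast]
      refine ENNReal.ofReal_le_ofReal ?_
      -- A round costs at most 11n + 14 ≤ 25n steps, as n ≥ 1.
      have h1 : runTime t A.card (rounds t A ω) ≤
          9 * t + 2 + 25 * (A.card * rounds t A ω) := by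
        rw [runTime, if_neg hA.card_pos.ne']
        refine Nat.add_le_add_left ?_ _
        calc _ ≤ ∑ r ∈ Finset.range (rounds t A ω), 25 * A.card :=
              Finset.sum_le_sum fun r _ => by
                have := hA.card_pos
                split_ifs <;> omega
          _ = _ := by rw [Finset.sum_const, Finset.card_range, smul_eq_mul]; ring
      exact_mod_cast h1
    refine (lintegral_mono hpt).trans ?_
    have hint : Integrable (fun ω => 9 * t + 2 + 25 * (A.card * (rounds t A ω : ℝ))) hashLaw :=
      (integrable_const _).add (((integrable_rounds A).const_mul _).const_mul _)
    rw [← ofReal_integral_eq_lintegral_ofReal hint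
      (Filter.Eventually.of_forall fun ω => by simp only [Pi.zero_apply]; positivity)]
    refine ENNReal.ofReal_le_ofReal ?_
    rw [integral_add (integrable_const _) (((integrable_rounds A).const_mul _).const_mul _),
      integral_const, probReal_univ, one_smul, integral_const_mul, integral_const_mul]
    have h1 := mul_integral_rounds_le ht hA
    have h2 : (t : ℝ) ≤ 2 * (t * Real.log t) + A.card := by
      rcases Nat.lt_or_ge t 2 with h | h
      · obtain rfl : t = 1 := by omega
        rw [Nat.cast_one] at hlog0 ⊢
        linarith
      · linarith [hlog h]
    linarith

end Time

/-! ### Agreement of two sketches -/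

section Similarity

variable {t : ℕ} {A B : Finset ℕ}

theorem measure_eq_inter_le (hU : (A ∪ B).Nonempty) (S : Finset (Fin t)) :
    hashLaw.real (⋂ i ∈ S, {ω | sketch t A ω i = sketch t B ω i}) ≤
      ((A ∩ B).card / (A ∪ B).card : ℝ) ^ S.card := by
  refine le_trans (le_of_eq (measureReal_congr ?_)) (measure_wins_le hU
    (Finset.inter_subset_left.trans Finset.subset_union_left) S)
  rw [Filter.eventuallyEq_set]
  filter_upwards [ae_noTies] with ω hω
  simp only [Set.mem_iInter, Set.mem_ofPred_eq]
  exact forall₂_congr fun i _ => sketch_eq_iff_wins hω hU i.2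

theorem measure_ne_inter_le (hU : (A ∪ B).Nonempty) (S : Finset (Fin t)) :
    hashLaw.real (⋂ i ∈ S, {ω | sketch t A ω i = sketch t B ω i}ᶜ) ≤
      (1 - (A ∩ B).card / (A ∪ B).card : ℝ) ^ S.card := by
  have hI : A ∩ B ⊆ A ∪ B := Finset.inter_subset_left.trans Finset.subset_union_left
  have h := measure_wins_le hU (t := t) (Finset.sdiff_subset (s := A ∪ B) (t := A ∩ B)) S
  rw [Finset.card_sdiff_of_subset hI, Nat.cast_sub (Finset.card_le_card hI), sub_div,
    div_self (Nat.cast_ne_zero.2 hU.card_pos.ne')] at h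
  refine le_trans (le_of_eq (measureReal_congr ?_)) h
  rw [Filter.eventuallyEq_set]
  filter_upwards [ae_noTies] with ω hω
  simp only [Set.mem_iInter, Set.mem_ofPred_eq, Set.mem_compl_iff]
  refine forall₂_congr fun i _ => ?_
  rw [wins_sdiff_iff hω hU i.2, sketch_eq_iff_wins hω hU i.2]

theorem measurableSet_sketch_eq (A B : Finset ℕ) (i : ℕ) :
    MeasurableSet {ω | sketch t A ω i = sketch t B ω i} :=
  measurableSet_eq_fun (measurable_sketch A i) (measurable_sketch B i)

/-- The bounds J for agreement and 1 - J for disagreement in one bin add up to 1, so both are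
equalities. -/
theorem measure_sketch_eq (hU : (A ∪ B).Nonempty) (i : Fin t) :
    hashLaw.real {ω | sketch t A ω i = sketch t B ω i} = (A ∩ B).card / (A ∪ B).card := by
  have h1 := measure_eq_inter_le hU {i}
  have h2 := measure_ne_inter_le hU {i}
  simp only [Finset.mem_singleton, Set.iInter_iInter_eq_left, Finset.card_singleton, pow_one]
    at h1 h2
  rw [probReal_compl_eq_one_sub (measurableSet_sketch_eq A B i)] at h2
  linarith

theorem agreement_eq_integral (hU : (A ∪ B).Nonempty) (ht : 0 < t) :
    Integrable (fun ω => agreement (t := t) (fun i => sketch t A ω i) (fun i => sketch t B ω i))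
      hashLaw ∧
    ∫ ω, agreement (t := t) (fun i => sketch t A ω i) (fun i => sketch t B ω i) ∂hashLaw =
      (A ∩ B).card / (A ∪ B).card := by
  have h1 : (fun ω => agreement (t := t) (fun i => sketch t A ω i) (fun i => sketch t B ω i)) =
      fun ω => (1 / (t : ℝ)) * ∑ i : Fin t,
        {ω | sketch t A ω i = sketch t B ω i}.indicator (fun _ => (1 : ℝ)) ω := by
    funext ω
    rw [agreement]
    congr 1
  have hint : ∀ i ∈ (Finset.univ : Finset (Fin t)),
      Integrable ({ω | sketch t A ω i = sketch t B ω i}.indicator (fun _ => (1 : ℝ))) hashLaw :=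
    fun i _ => (integrable_const _).indicator (measurableSet_sketch_eq A B i)
  rw [h1]
  refine ⟨(integrable_finsetSum _ hint).const_mul _, ?_⟩
  rw [integral_const_mul, integral_finsetSum _ hint]
  simp only [integral_indicator_const _ (measurableSet_sketch_eq A B _), smul_eq_mul, mul_one,
    measure_sketch_eq hU, Finset.sum_const, Finset.card_univ, Fintype.card_fin, nsmul_eq_mul]
  field_simp

open Classical in
theorem agreement_eq_card_div (A B : Finset ℕ) (ω : HashFamily) :
    agreement (t := t) (fun i => sketch t A ω i) (fun i => sketch t B ω i) =
      (Finset.univ.filter fun i : Fin t =>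
        ω ∈ {ω | sketch t A ω i = sketch t B ω i}).card / t := by
  rw [agreement, Finset.sum_ite, one_div_mul_eq_div]
  simp

theorem measure_agreement_ge_le (hU : (A ∪ B).Nonempty) (ht : 0 < t) {δ : ℝ} (hδ : 0 < δ) :
    hashLaw.real {ω | agreement (t := t) (fun i => sketch t A ω i) (fun i => sketch t B ω i) ≥
        (A ∩ B).card / (A ∪ B).card * (1 + δ)} ≤
      (Real.exp δ / (1 + δ) ^ (1 + δ)) ^ ((t : ℝ) * ((A ∩ B).card / (A ∪ B).card)) := by
  have ht' : (0 : ℝ) < t := by exact_mod_cast ht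
  refine le_trans (measureReal_mono fun ω hω => ?_) (measure_card_ge_le (t := t)
    (fun i => measurableSet_sketch_eq A B i) (by positivity) (measure_eq_inter_le hU) hδ)
  rw [Set.mem_ofPred_eq, agreement_eq_card_div, ge_iff_le, le_div_iff₀ ht'] at hω
  rw [Set.mem_ofPred_eq]
  linarith

theorem measure_agreement_le_le (hU : (A ∪ B).Nonempty) (ht : 0 < t) {δ : ℝ} (hδ : 0 < δ)
    (hδ1 : δ ≤ 1) :
    hashLaw.real {ω | agreement (t := t) (fun i => sketch t A ω i) (fun i => sketch t B ω i) ≤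
        (A ∩ B).card / (A ∪ B).card * (1 - δ)} ≤
      (Real.exp (-δ) / (1 - δ) ^ (1 - δ)) ^ ((t : ℝ) * ((A ∩ B).card / (A ∪ B).card)) := by
  have ht' : (0 : ℝ) < t := by exact_mod_cast ht
  have hJ : ((A ∩ B).card / (A ∪ B).card : ℝ) ≤ 1 := by
    refine div_le_one_of_le₀ ?_ (Nat.cast_nonneg _)
    exact_mod_cast Finset.card_le_card (Finset.inter_subset_left.trans Finset.subset_union_left)
  refine le_trans (measureReal_mono fun ω hω => ?_) (measure_card_le_le (t := t)
    (fun i => measurableSet_sketch_eq A B i) (by positivity) hJ (measure_ne_inter_le hU) hδ hδ1)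
  rw [Set.mem_ofPred_eq, agreement_eq_card_div, div_le_iff₀ ht'] at hω
  rw [Set.mem_ofPred_eq]
  linarith

end Similarity

end FastSketch

end

/-! ### Assembly -/

open FastSketch in
/-- One program `P` and one constant `C` serve all universes `[u]`, sketch sizes `t` and sets.
`v A ω` is the vector that `P` outputs (in the first `t` cells of the real memory) on the set `A`,
whatever the order in which the elements of `A` are listed, and `T l ω` is its running time on the
list `l`. The hash functions `ω` are drawn once and used for all sets. -/
theorem theorem1 :
    ∃ (P : FastSketch.Program) (C : ℝ), ∀ (u t : ℕ), 0 < t →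
      ∃ (v : Finset (Fin u) → FastSketch.HashFamily → Fin t → ℝ)
        (T : List (Fin u) → FastSketch.HashFamily → ℕ),
        -- the program computes `v A` in time `T`, on every list of the elements of `A`
        (∀ (A : Finset (Fin u)) (l : List (Fin u)), l.Nodup → l.toFinset = A →
          ∀ ω : FastSketch.HashFamily, ∃ s : FastSketch.Config,
            FastSketch.HaltsIn P ω (FastSketch.init t l) (T l ω) s ∧
              ∀ i : Fin t, s.rmem (i : ℕ) = v A ω i) ∧
        -- the output and the running time are random variables
        (∀ (A : Finset (Fin u)) (i : Fin t), Measurable (fun ω => v A ω i)) ∧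
        (∀ l : List (Fin u), l.Nodup → Measurable (T l)) ∧
        -- expected running time `O(|A| + t log t)`; this is `O(0)` for `A = ∅`, `t = 1`
        (∀ (A : Finset (Fin u)) (l : List (Fin u)), l.Nodup → l.toFinset = A →
          (A.Nonempty ∨ 2 ≤ t) →
          ∫⁻ ω, (T l ω : ENNReal) ∂FastSketch.hashLaw ≤
            ENNReal.ofReal (C * ((A.card : ℝ) + (t : ℝ) * Real.log (t : ℝ)))) ∧
        -- non-negative coordinates
        (∀ (A : Finset (Fin u)) (ω : FastSketch.HashFamily) (i : Fin t), 0 ≤ v A ω i) ∧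
        -- sketches of unions
        (∀ (A B : Finset (Fin u)) (ω : FastSketch.HashFamily) (i : Fin t),
          v (A ∪ B) ω i = min (v A ω i) (v B ω i)) ∧
        -- similarity estimation
        (∀ A B : Finset (Fin u), (A ∪ B).Nonempty →
          Integrable (fun ω => FastSketch.agreement (v A ω) (v B ω)) FastSketch.hashLaw ∧
          (∫ ω, FastSketch.agreement (v A ω) (v B ω) ∂FastSketch.hashLaw) =
            FastSketch.jaccard A B ∧
          (∀ δ : ℝ, 0 < δ →
            FastSketch.hashLaw.real
                {ω | FastSketch.agreement (v A ω) (v B ω) ≥ FastSketch.jaccard A B * (1 + δ)} ≤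
              (Real.exp δ / (1 + δ) ^ (1 + δ)) ^ ((t : ℝ) * FastSketch.jaccard A B)) ∧
          (∀ δ : ℝ, 0 < δ → δ ≤ 1 →
            FastSketch.hashLaw.real
                {ω | FastSketch.agreement (v A ω) (v B ω) ≤ FastSketch.jaccard A B * (1 - δ)} ≤
              (Real.exp (-δ) / (1 - δ) ^ (1 - δ)) ^
                ((t : ℝ) * FastSketch.jaccard A B))) := by
  refine ⟨sketchProgram, 200, fun u t ht =>
    ⟨fun A ω i => sketch t (A.map Fin.valEmbedding) ω i,
      fun l ω => runTime t l.length (rounds t (l.toFinset.map Fin.valEmbedding) ω),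
      ?_, ?_, ?_, ?_, ?_, ?_, ?_⟩⟩
  · rintro A l - rfl ω
    have hl : (l.map Fin.val).toFinset = l.toFinset.map Fin.valEmbedding := by
      ext x; simp
    obtain ⟨s, hs, hv⟩ := haltsIn_sketchProgram (ω := ω) ht (L := l.map Fin.val) (s := init t l)
      rfl (by rw [List.length_map]; rfl) (fun _ => rfl)
    rw [hl, List.length_map] at hs
    rw [hl] at hv
    exact ⟨s, hs, fun i => hv i i.2⟩
  · exact fun A i => measurable_sketch _ _
  · exact fun l _ => (measurable_from_top (f := runTime t l.length)).comp (measurable_rounds _)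
  · rintro A l hl rfl hAt
    have h := lintegral_runTime_le ht (l.toFinset.map Fin.valEmbedding) (by simpa using hAt)
    rw [Finset.card_map, List.toFinset_card_of_nodup hl] at h
    rwa [List.toFinset_card_of_nodup hl]
  · exact fun A ω i => sketch_nonneg
  · intro A B ω i
    simp only [Finset.map_union]
    exact sketch_union _ _
  · intro A B hU
    have hU' : (A.map Fin.valEmbedding ∪ B.map Fin.valEmbedding).Nonempty := by
      rwa [← Finset.map_union, Finset.map_nonempty]
    have hJ : jaccard A B =
        ((A.map Fin.valEmbedding ∩ B.map Fin.valEmbedding).card : ℝ) /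
          (A.map Fin.valEmbedding ∪ B.map Fin.valEmbedding).card := by
      rw [← Finset.map_union, ← Finset.map_inter, Finset.card_map, Finset.card_map, jaccard]
    rw [hJ]
    obtain ⟨h1, h2⟩ := agreement_eq_integral hU' ht
    exact ⟨h1, h2, fun δ hδ => measure_agreement_ge_le hU' ht hδ,
      fun δ hδ hδ1 => measure_agreement_le_le hU' ht hδ hδ1⟩
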